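/- Let $K,M\ge 2$ be integers. Let $0<\underline E\le E_{k,m}\le\overline E<\infty$ and $0<\underline P\le P_{m,k}\le\overline P<\infty$ be deterministic for $1\le k\le K$, $1\le m\le M$, let $P_{\rm rel}>0$ and $\sigma>0$, and let $h_{k,m}$, $f_{m,k}$ ($1\le k\le K$, $1\le m\le M$) be jointly independent circularly symmetric complex Gaussian random variables with mean $0$ and variance $1$. Write $\tilde z=e^{j\arg z}$ for $z\in\mathbb C$, and put $$d_k=\sqrt{P_{\rm rel}}\Bigl[K\sum_{m=1}^M E_{k,m}+MK\sigma^2\Bigr]^{-1/2},\quad C_k^{m,\hat m}=\sqrt{KM}\,d_k\sqrt{P_{m,k}E_{k,\hat m}},\quad C_k^{m}=\sqrt{KM}\,d_k\sqrt{P_{m,k}},$$ $$a_k^{m,\hat m,\tilde m}=C_k^{m,\hat m}\,\overline{\tilde f_{\tilde m,k}}\,f_{m,k}\,\overline{\tilde h_{k,\tilde m}}\,h_{k,\hat m},\qquad b_k^{m,\tilde m}=C_k^{m}\,\overline{\tilde f_{\tilde m,k}}\,f_{m,k}\,\overline{\tilde h_{k,\tilde m}}.$$ The effective SINR of the $m$th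 source-destination link under protocol P2 is $$\mathrm{SINR}^{\rm P2}_m=\frac{\bigl|\sum_{k=1}^K\sum_{\tilde m=1}^M a_k^{m,m,\tilde m}\bigr|^2}{\sum_{\hat m\ne m}\bigl|\sum_{k=1}^K\sum_{\tilde m=1}^M a_k^{m,\hat m,\tilde m}\bigr|^2+\sigma^2M\sum_{k=1}^K\bigl|\sum_{\tilde m=1}^M b_k^{m,\tilde m}\bigr|^2+KM^2\sigma^2}.$$ Define the positive constants $\underline C,\overline C,\underline c,\overline c,\underline C_{\rm SN},\overline C_{\rm SN}$ by $$\underline C^2=\frac{\underline P\,\underline E\,P_{\rm rel}}{\overline E+\sigma^2},\quad \overline C^2=\frac{\overline P\,\overline E\,P_{\rm rel}}{\underline E+\sigma^2},\quad \underline c^2=\frac{\underline P\,P_{\rm rel}}{\overline E+\sigma^2},\quad \overline c^2=\frac{\overline P\,P_{\rm rel}}{\underline E+\sigma^2},$$ $$\underline C_{\rm SN}^2=\underline C^2+\sigma^2(\underline c^2+1),\qquad \overline C_{\rm SN}^2=\overline C^2+\sigma^2(\overline c^2+1),$$ and let $$L_{\rm P2}(x)=\frac{\pi^2}{16}\frac{\underline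 C^2}{\overline C_{\rm SN}^2}\frac{K}{M^2}\,\frac{\max\bigl[0,\,1-\frac{8}{\underline C\pi}\sqrt{\frac MK}\,x\bigr]^2}{\frac{\overline C^2}{\overline C_{\rm SN}^2}+\frac{4}{\overline C_{\rm SN}^2}\frac{x}{\min[\sqrt M,\sqrt K]}+\frac{\sigma^2}{\overline C_{\rm SN}^2}\bigl(\overline c^2+2\frac{x}{\sqrt K}\bigr)+\frac{\sigma^2}{\overline C_{\rm SN}^2}},$$ $$U_{\rm P2}(x)=\frac{\pi^2}{16}\frac{\overline C^2}{\underline C_{\rm SN}^2}\frac{K}{M^2}\,\frac{\bigl(1+\frac{8}{\overline C\pi}\sqrt{\frac MK}\,x\bigr)^2}{\max\bigl[0,\,\frac{\underline C^2}{\underline C_{\rm SN}^2}\frac{M-1}{M}-\frac{4}{\underline C_{\rm SN}^2}\frac{x}{\min[\sqrt M,\sqrt K]}\bigr]+\max\bigl[0,\,\frac{\sigma^2}{\underline C_{\rm SN}^2}\bigl(\underline c^2-2\frac{x}{\sqrt K}\bigr)\bigr]+\frac{\sigma^2}{\underline C_{\rm SN}^2}}.$$ Then for every $x\ge1$ and every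 $m\in\{1,\dots,M\}$, $$\Pr\bigl\{\mathrm{SINR}^{\rm P2}_m\notin[L_{\rm P2}(x),U_{\rm P2}(x)]\bigr\}\le 814\,K^2M^3e^{-\Delta_{\rm P2}\,x^{2/9}},$$ where $\Delta_{\rm P2}=\min\bigl[2^{-11/5},\ 1/(2^{61/36}\,\overline C^{2}),\ 1/(8\,\overline C^{4}),\ 1/(4\,\overline c^{4})\bigr]$. -/

import Mathlib

open MeasureTheory ProbabilityTheory
open scoped NNReal ComplexConjugate

noncomputable section

namespace RelayNetwork

/-- The circularly symmetric complex Gaussian law with mean zero and variance `v`: the law of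
`X + iY` with `X`, `Y` independent real Gaussians with mean `0` and variance `v / 2`. -/
def circGaussian (v : ℝ≥0) : Measure ℂ :=
  ((gaussianReal 0 (v / 2)).prod (gaussianReal 0 (v / 2))).map
    (fun p : ℝ × ℝ => (⟨p.1, p.2⟩ : ℂ))

/-- Numerical constants of the network: lower and upper bounds on the average energies of the
first-hop links (`Elo`, `Ehi`) and of the second-hop links (`Plo`, `Phi`), the total power
`Prel` available to the relays, and the noise standard deviation `sigma`. -/
structure Constants where
  Elo : ℝ
  Ehi : ℝ
  Plo : ℝ
  Phi : ℝ
  Prel : ℝ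
  sigma : ℝ

namespace Constants

/-- The lower bound on the coefficients `C_k^{m,m'}`. -/
def Clo (c : Constants) : ℝ := √(c.Plo * c.Elo * c.Prel / (c.Ehi + c.sigma ^ 2))

/-- The upper bound on the coefficients `C_k^{m,m'}`. -/
def Chi (c : Constants) : ℝ := √(c.Phi * c.Ehi * c.Prel / (c.Elo + c.sigma ^ 2))

/-- The lower bound on the coefficients `C_k^m`. -/
def clo (c : Constants) : ℝ := √(c.Plo * c.Prel / (c.Ehi + c.sigma ^ 2))

/-- The upper bound on the coefficients `C_k^m`. -/
def chi (c : Constants) : ℝ := √(c.Phi * c.Prel / (c.Elo + c.sigma ^ 2))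

def CSNlo (c : Constants) : ℝ := √(c.Clo ^ 2 + c.sigma ^ 2 * (c.clo ^ 2 + 1))

def CSNhi (c : Constants) : ℝ := √(c.Chi ^ 2 + c.sigma ^ 2 * (c.chi ^ 2 + 1))

end Constants

/-- The phase factor `exp (i arg z)`. -/
def phase (z : ℂ) : ℂ := Complex.exp (Complex.I * (Complex.arg z : ℂ))

section SINR

variable {K M : ℕ}

/-- The relay gain `d_k`, which makes relay `k` transmit with average power `Prel / K`. -/
def dP2 (c : Constants) (E : Fin K → Fin M → ℝ) (k : Fin K) : ℝ :=
  √c.Prel * (√((K : ℝ) * ∑ m : Fin M, E k m + (M : ℝ) * (K : ℝ) * c.sigma ^ 2))⁻¹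

/-- The coefficient `C_k^{m,m'}`. -/
def coeffBig (c : Constants) (E : Fin K → Fin M → ℝ) (P : Fin M → Fin K → ℝ)
    (m m' : Fin M) (k : Fin K) : ℝ :=
  √((K : ℝ) * (M : ℝ)) * dP2 c E k * √(P m k * E k m')

/-- The coefficient `C_k^m`. -/
def coeffSmall (c : Constants) (E : Fin K → Fin M → ℝ) (P : Fin M → Fin K → ℝ)
    (m : Fin M) (k : Fin K) : ℝ :=
  √((K : ℝ) * (M : ℝ)) * dP2 c E k * √(P m k)

/-- The term `a_k^{m,m',n}`: the contribution of source `m'` to destination `m` through relay `k`,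
cophased for the source-destination pair `n`. -/
def aTerm (c : Constants) (E : Fin K → Fin M → ℝ) (P : Fin M → Fin K → ℝ)
    (H : Fin K → Fin M → ℂ) (F : Fin M → Fin K → ℂ) (m m' n : Fin M) (k : Fin K) : ℂ :=
  (coeffBig c E P m m' k : ℂ) * conj (phase (F n k)) * F m k * conj (phase (H k n)) * H k m'

/-- The term `b_k^{m,n}`: the gain of the noise of relay `k` towards destination `m`, cophased for
the source-destination pair `n`. -/
def bTerm (c : Constants) (E : Fin K → Fin M → ℝ) (P : Fin M → Fin K → ℝ)
    (H : Fin K → Fin M → ℂ) (F : Fin M → Fin K → ℂ) (m n : Fin M) (k : Fin K) : ℂ :=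
  (coeffSmall c E P m k : ℂ) * conj (phase (F n k)) * F m k * conj (phase (H k n))

/-- The effective signal-to-interference-plus-noise ratio of link `m` in the second protocol, as a
function of the channel matrices `H` (sources to relays) and `F` (relays to destinations). -/
def sinrP2 (c : Constants) (E : Fin K → Fin M → ℝ) (P : Fin M → Fin K → ℝ)
    (H : Fin K → Fin M → ℂ) (F : Fin M → Fin K → ℂ) (m : Fin M) : ℝ :=
  ‖∑ k : Fin K, ∑ n : Fin M, aTerm c E P H F m m n k‖ ^ 2 /
    (∑ m' ∈ Finset.univ.erase m, ‖∑ k : Fin K, ∑ n : Fin M, aTerm c E P H F m m' n k‖ ^ 2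
      + c.sigma ^ 2 * (M : ℝ) * ∑ k : Fin K, ‖∑ n : Fin M, bTerm c E P H F m n k‖ ^ 2
      + (K : ℝ) * (M : ℝ) ^ 2 * c.sigma ^ 2)

end SINR

/-- The lower end of the concentration interval. -/
def LP2 (c : Constants) (K M : ℕ) (x : ℝ) : ℝ :=
  Real.pi ^ 2 / 16 * (c.Clo ^ 2 / c.CSNhi ^ 2) * ((K : ℝ) / (M : ℝ) ^ 2) *
    ((max 0 (1 - 8 / (c.Clo * Real.pi) * √((M : ℝ) / (K : ℝ)) * x)) ^ 2 /
      (c.Chi ^ 2 / c.CSNhi ^ 2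
        + 4 / c.CSNhi ^ 2 * (x / min √(M : ℝ) √(K : ℝ))
        + c.sigma ^ 2 / c.CSNhi ^ 2 * (c.chi ^ 2 + 2 * (x / √(K : ℝ)))
        + c.sigma ^ 2 / c.CSNhi ^ 2))

/-- The upper end of the concentration interval. -/
def UP2 (c : Constants) (K M : ℕ) (x : ℝ) : ℝ :=
  Real.pi ^ 2 / 16 * (c.Chi ^ 2 / c.CSNlo ^ 2) * ((K : ℝ) / (M : ℝ) ^ 2) *
    ((1 + 8 / (c.Chi * Real.pi) * √((M : ℝ) / (K : ℝ)) * x) ^ 2 /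
      (max 0 (c.Clo ^ 2 / c.CSNlo ^ 2 * (((M : ℝ) - 1) / (M : ℝ))
          - 4 / c.CSNlo ^ 2 * (x / min √(M : ℝ) √(K : ℝ)))
        + max 0 (c.sigma ^ 2 / c.CSNlo ^ 2 * (c.clo ^ 2 - 2 * (x / √(K : ℝ))))
        + c.sigma ^ 2 / c.CSNlo ^ 2))

/-- The constant in the exponent of the tail bound. -/
def DeltaP2 (c : Constants) : ℝ :=
  min (min ((2 : ℝ) ^ (-(11 / 5) : ℝ)) (1 / ((2 : ℝ) ^ (61 / 36 : ℝ) * c.Chi ^ 2)))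
    (min (1 / (8 * c.Chi ^ 4)) (1 / (4 * c.chi ^ 4)))

end RelayNetwork

end

/-!
The signal that destination `m` receives from source `m'` is `T m' = ∑ k, C k m' f_k g_k h_{k m'}`,
where `f_k` and `h_{k m'}` are the Gaussian channels through relay `k` and `g_k` (`phaseSum`) is the
sum over all pairs `n` of the factors cophasing the two channels of `n` at relay `k`. The SINR is
`|T m| ^ 2` divided by interference `∑ m' ≠ m, |T m'| ^ 2`, relay noise `∑ k, c_k ^ 2 |f_k g_k| ^ 2`
and a constant, so it is enough to confine these three quantities (`sinr_mem_Icc`).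

The Gaussian law is invariant under sign changes, so the channels may be multiplied by arbitrary
signs, and the probability of an event may be computed by averaging over random signs for fixed
channels (`measureReal_le_of_flip`). Well-chosen flips turn every oscillating part into a
Rademacher sum or into a sum of squares of independent Rademacher sums, whose tails are bounded in
units of the Euclidean norm of the coefficients, whatever the channels are:

* flipping the channels of the pairs `n ≠ m` makes the part of `T m` cophased for other pairs a
  Rademacher sum (`crossTerm_tail`);
* flipping `h_{k n}` makes `g_k` a Rademacher sum of `M` unimodular terms, so that `|g_k| ^ 2`
  averages to `M` (`phaseSum_tail`, `phaseSum_sq_tail`);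
* flipping both channels of a pair `n ≠ m` at relay `k` leaves `g_k` unchanged and changes the sign
  of the `k`-th term of `T n` only. The interferences become independent Rademacher sums, and
  `∑ |T m'| ^ 2` concentrates around `∑ m', ∑ k |C k m' f_k g_k h_{k m'}| ^ 2` (`interference_tail`).

What remains are weighted sums of independent channel powers and amplitude products, which are
subexponential (`subexponential_tail`).

At the level `τ = Δ x ^ (2/9)` each of these events fails with probability at most `4 exp (-τ)`, and
there are `O(K M)` of them (`measureReal_not_typical_le`). On the good event (`Typical`) the
deviations are at most a constant times `τ ^ 4` in units of the margins of the statement. If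
`τ ≤ 1` the bound exceeds `1`; otherwise `x = (τ / Δ) ^ (9/2)` dominates `τ ^ 4` with all the
required constants (`x_lower_bounds`).
-/

noncomputable section

namespace RelayNetwork

/-! ### Concentration of sums of independent subexponential variables -/

theorem exp_le_one_add_add_sq_mul_exp_abs (u : ℝ) :
    Real.exp u ≤ 1 + u + u ^ 2 * Real.exp |u| := by
  have h := Complex.norm_exp_sub_sum_le_norm_mul_exp (u : ℂ) 2
  have h2 : Complex.exp (u : ℂ) - ∑ m ∈ Finset.range 2, (u : ℂ) ^ m / (m.factorial : ℂ)
      = ((Real.exp u - (1 + u) : ℝ) : ℂ) := by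
    simp [Finset.sum_range_succ]
  rw [h2, Complex.norm_real, Complex.norm_real] at h
  have h3 := (abs_le.1 h).2
  simp only [Real.norm_eq_abs, sq_abs] at h3
  linarith

theorem sq_mul_exp_quarter_le {y : ℝ} (hy : 0 ≤ y) :
    y ^ 2 * Real.exp (y / 4) ≤ 32 * Real.exp (y / 2) := by
  have h1 : y / 2 = y / 4 + y / 4 := by ring
  rw [h1, Real.exp_add]
  have h2 := Real.quadratic_le_exp_of_nonneg (x := y / 4) (by positivity)
  have h3 := Real.exp_pos (y / 4)
  nlinarith

theorem integrable_of_integrable_exp_half {Ω : Type*} [MeasurableSpace Ω] {P : Measure Ω}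
    {Y : Ω → ℝ} (hY : Measurable Y) (hY0 : ∀ ω, 0 ≤ Y ω)
    (hint : Integrable (fun ω => Real.exp (Y ω / 2)) P) : Integrable Y P := by
  refine (hint.const_mul 2).mono' hY.aestronglyMeasurable (ae_of_all _ fun ω => ?_)
  rw [Real.norm_eq_abs, abs_of_nonneg (hY0 ω)]
  linarith [Real.add_one_le_exp (Y ω / 2)]

/-- A nonnegative variable with `E exp (Y / 2) ≤ 4` has, once centred, a subgaussian moment
generating function on `[-1/4, 1/4]`. -/
theorem mgf_le_of_integral_exp_half_le {Ω : Type*} [MeasurableSpace Ω] {P : Measure Ω}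
    [IsProbabilityMeasure P] {Y : Ω → ℝ} (hY : Measurable Y) (hY0 : ∀ ω, 0 ≤ Y ω)
    (hint : Integrable (fun ω => Real.exp (Y ω / 2)) P)
    (hE : ∫ ω, Real.exp (Y ω / 2) ∂P ≤ 4) {l : ℝ} (hl : |l| ≤ 1 / 4) :
    Integrable (fun ω => Real.exp (l * (Y ω - ∫ ω, Y ω ∂P))) P ∧
      ∫ ω, Real.exp (l * (Y ω - ∫ ω, Y ω ∂P)) ∂P ≤ Real.exp (128 * l ^ 2) := by
  have hYint := integrable_of_integrable_exp_half hY hY0 hint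
  have hpt : ∀ ω, Real.exp (l * Y ω) ≤ 1 + l * Y ω + 32 * l ^ 2 * Real.exp (Y ω / 2) := fun ω => by
    refine (exp_le_one_add_add_sq_mul_exp_abs _).trans ?_
    have h1 : |l * Y ω| ≤ Y ω / 4 := by
      rw [abs_mul, abs_of_nonneg (hY0 ω)]
      nlinarith [hY0 ω]
    have h2 : Y ω ^ 2 * Real.exp |l * Y ω| ≤ 32 * Real.exp (Y ω / 2) :=
      le_trans (by gcongr) (sq_mul_exp_quarter_le (hY0 ω))
    have h3 := mul_le_mul_of_nonneg_left h2 (sq_nonneg l)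
    rw [mul_pow]
    linarith
  have hintl : Integrable (fun ω => Real.exp (l * Y ω)) P := by
    refine hint.mono' (by fun_prop) (ae_of_all _ fun ω => ?_)
    rw [Real.norm_eq_abs, abs_of_pos (Real.exp_pos _)]
    refine Real.exp_le_exp.2 ?_
    nlinarith [hY0 ω, (abs_le.1 hl).2]
  have heq : (fun ω => Real.exp (l * (Y ω - ∫ ω, Y ω ∂P)))
      = fun ω => Real.exp (-(l * ∫ ω, Y ω ∂P)) * Real.exp (l * Y ω) := by
    funext ω; rw [← Real.exp_add]; congr 1; ring
  rw [heq]
  refine ⟨hintl.const_mul _, ?_⟩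
  rw [integral_const_mul]
  have hle : ∫ ω, Real.exp (l * Y ω) ∂P ≤ Real.exp (l * (∫ ω, Y ω ∂P) + 128 * l ^ 2) := by
    calc ∫ ω, Real.exp (l * Y ω) ∂P
        ≤ ∫ ω, (1 + l * Y ω + 32 * l ^ 2 * Real.exp (Y ω / 2)) ∂P :=
          integral_mono hintl
            (((integrable_const _).add (hYint.const_mul _)).add (hint.const_mul _)) hpt
      _ = 1 + l * (∫ ω, Y ω ∂P) + 32 * l ^ 2 * ∫ ω, Real.exp (Y ω / 2) ∂P := by
          rw [integral_add (f := fun ω => 1 + l * Y ω)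
              ((integrable_const _).add (hYint.const_mul _)) (hint.const_mul _),
            integral_add (integrable_const _) (hYint.const_mul _), integral_const_mul,
            integral_const_mul]
          simp
      _ ≤ 1 + (l * (∫ ω, Y ω ∂P) + 128 * l ^ 2) := by nlinarith [sq_nonneg l]
      _ ≤ _ := by linarith [Real.add_one_le_exp (l * (∫ ω, Y ω ∂P) + 128 * l ^ 2)]
  refine (mul_le_mul_of_nonneg_left hle (Real.exp_nonneg _)).trans_eq ?_
  rw [← Real.exp_add]; congr 1; ring

/-- The one-sided form of `subexponential_tail`. -/
theorem subexponential_upper_tail {Ω : Type*} [MeasurableSpace Ω] {P : Measure Ω}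
    [IsProbabilityMeasure P] {ι : Type*} [Fintype ι] {Y : ι → Ω → ℝ}
    (hY : ∀ i, Measurable (Y i))
    (hY0 : ∀ i ω, 0 ≤ Y i ω) (hind : iIndepFun Y P)
    (hint : ∀ i, Integrable (fun ω => Real.exp (Y i ω / 2)) P)
    (hE : ∀ i, ∫ ω, Real.exp (Y i ω / 2) ∂P ≤ 4) (w : ι → ℝ) {τ : ℝ} (hτ : 1 ≤ τ) :
    P.real {ω | 36 * τ * √(∑ i, w i ^ 2) < ∑ i, w i * (Y i ω - ∫ ω, Y i ω ∂P)} ≤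
      Real.exp (-τ) := by
  set A := √(∑ i, w i ^ 2) with hA
  have hA2 : A ^ 2 = ∑ i, w i ^ 2 := Real.sq_sqrt (by positivity)
  -- If all weights vanish, the strict inequality defining the event is `0 < 0`.
  rcases (Real.sqrt_nonneg (∑ i, w i ^ 2)).eq_or_lt with h0 | hpos
  · have hw : ∀ i, w i = 0 := fun i => by
      have h1 : ∑ i, w i ^ 2 = 0 := by rw [← hA2, hA, ← h0]; simp
      have := (Finset.sum_eq_zero_iff_of_nonneg (fun i _ => sq_nonneg (w i))).1 h1 i
        (Finset.mem_univ i)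
      simpa using this
    have : A = 0 := h0.symm
    simp [hw, this, Real.exp_nonneg]
  have hApos : 0 < A := hpos
  have hwA : ∀ i, |w i| ≤ A := fun i => by
    refine Real.abs_le_sqrt ?_
    exact Finset.single_le_sum (f := fun i => w i ^ 2) (fun i _ => sq_nonneg (w i))
      (Finset.mem_univ i)
  -- The largest exponent for which every `s * w i` stays in `[-1/4, 1/4]`; the moment generating
  -- function of the whole sum at `s` is then at most `exp (128 / 16) = exp 8`.
  set s : ℝ := 1 / (4 * A) with hs
  have hs0 : 0 < s := by positivity
  have hl : ∀ i, |s * w i| ≤ 1 / 4 := fun i => by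
    rw [abs_mul, abs_of_pos hs0, hs, div_mul_eq_mul_div, one_mul, div_le_div_iff₀ (by positivity)
      (by norm_num)]
    linarith [hwA i]
  have hm := fun i => mgf_le_of_integral_exp_half_le (hY i) (hY0 i) (hint i) (hE i) (hl i)
  set X : ι → Ω → ℝ := fun i ω => w i * (Y i ω - ∫ ω, Y i ω ∂P) with hX
  have hXm : ∀ i, Measurable (X i) := fun i => by simp only [hX]; fun_prop
  have hXind : iIndepFun X P :=
    hind.comp (fun i y => w i * (y - ∫ ω, Y i ω ∂P)) (fun i => by fun_prop)
  have hXe : ∀ i ω, Real.exp (s * X i ω) = Real.exp (s * w i * (Y i ω - ∫ ω, Y i ω ∂P)) :=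
    fun i ω => by simp only [hX]; congr 1; ring
  have hXint : Integrable (fun ω => Real.exp (s * (∑ i, X i) ω)) P :=
    hXind.integrable_exp_mul_sum hXm (s := Finset.univ)
      fun i _ => by simp only [hXe]; exact (hm i).1
  have hch := measure_ge_le_exp_mul_mgf (μ := P) (X := ∑ i, X i) (36 * τ * A) hs0.le hXint
  have hmgf : mgf (∑ i, X i) P s ≤ Real.exp 8 := by
    rw [hXind.mgf_sum hXm]
    calc ∏ i, mgf (X i) P s ≤ ∏ i, Real.exp (128 * (s * w i) ^ 2) := by
          refine Finset.prod_le_prod (fun i _ => mgf_nonneg) fun i _ => ?_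
          simp only [mgf, hXe]
          exact (hm i).2
      _ = Real.exp (128 * s ^ 2 * A ^ 2) := by
          rw [← Real.exp_sum, hA2, Finset.mul_sum]
          congr 1; exact Finset.sum_congr rfl fun i _ => by ring
      _ = Real.exp 8 := by
          congr 1; rw [hs]; field_simp; norm_num
  calc P.real {ω | 36 * τ * A < ∑ i, w i * (Y i ω - ∫ ω, Y i ω ∂P)}
      ≤ P.real {ω | 36 * τ * A ≤ (∑ i, X i) ω} := by
        refine measureReal_mono (fun ω hω => ?_)
        simp only [Set.mem_ofPred_eq, Finset.sum_apply, hX] at hω ⊢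
        exact hω.le
    _ ≤ Real.exp (-s * (36 * τ * A)) * Real.exp 8 := by
        refine hch.trans ?_
        gcongr
    _ ≤ Real.exp (-τ) := by
        rw [← Real.exp_add]
        refine Real.exp_le_exp.2 ?_
        have : s * A = 1 / 4 := by rw [hs]; field_simp
        have : -s * (36 * τ * A) = - (9 * τ) := by linear_combination -36 * τ * this
        linarith

/-- Bernstein-type inequality, normalised by the Euclidean norm of the weights. -/
theorem subexponential_tail {Ω : Type*} [MeasurableSpace Ω] {P : Measure Ω}
    [IsProbabilityMeasure P] {ι : Type*} [Fintype ι] {Y : ι → Ω → ℝ}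
    (hY : ∀ i, Measurable (Y i))
    (hY0 : ∀ i ω, 0 ≤ Y i ω) (hind : iIndepFun Y P)
    (hint : ∀ i, Integrable (fun ω => Real.exp (Y i ω / 2)) P)
    (hE : ∀ i, ∫ ω, Real.exp (Y i ω / 2) ∂P ≤ 4) (w : ι → ℝ) {τ : ℝ} (hτ : 1 ≤ τ) :
    P.real {ω | 36 * τ * √(∑ i, w i ^ 2) < |∑ i, w i * (Y i ω - ∫ ω, Y i ω ∂P)|} ≤
      2 * Real.exp (-τ) := by
  have h1 := subexponential_upper_tail hY hY0 hind hint hE w hτ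
  have h2 := subexponential_upper_tail hY hY0 hind hint hE (fun i => - w i) hτ
  simp only [neg_sq, neg_mul, Finset.sum_neg_distrib] at h2
  rw [two_mul]
  refine (measureReal_mono ?_).trans ((measureReal_union_le _ _).trans (add_le_add h1 h2))
  intro ω hω
  simpa [lt_abs] using hω

/-! ### Random signs -/

/-- The sign `1` or `-1` encoded by a Boolean. -/
def sgn (b : Bool) : ℝ := if b then 1 else -1

theorem sgn_mul_self (b : Bool) : sgn b * sgn b = 1 := by cases b <;> simp [sgn]

/-- The fair coin. -/
def coin : Measure Bool :=
  (2⁻¹ : ENNReal) • Measure.dirac true + (2⁻¹ : ENNReal) • Measure.dirac false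

instance : IsProbabilityMeasure coin := ⟨by simp [coin, ENNReal.inv_two_add_inv_two]⟩

theorem integral_coin (g : Bool → ℝ) : ∫ b, g b ∂coin = (g true + g false) / 2 := by
  rw [coin, integral_add_measure (Integrable.of_finite.smul_measure (by simp))
    (Integrable.of_finite.smul_measure (by simp)), integral_smul_measure, integral_smul_measure]
  simp
  ring

/-- The law of a finite family of independent fair coins. -/
abbrev coins (β : Type*) [Fintype β] : Measure (β → Bool) := Measure.pi fun _ => coin

section Rademacher

/-- The Rademacher sum with coefficients `a`. -/
def rsum {β : Type*} [Fintype β] (a : β → ℝ) (r : β → Bool) : ℝ := ∑ b, sgn (r b) * a b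

variable {β : Type*} [Fintype β]

/-- Rademacher sums are subgaussian, since `cosh u ≤ exp (u ^ 2 / 2)`. -/
theorem integral_exp_mul_rsum_le (a : β → ℝ) (l : ℝ) :
    ∫ r, Real.exp (l * rsum a r) ∂(coins β) ≤ Real.exp (l ^ 2 * (∑ b, a b ^ 2) / 2) := by
  have h1 : ∀ r : β → Bool, Real.exp (l * rsum a r) = ∏ b, Real.exp (l * (sgn (r b) * a b)) :=
    fun r => by rw [rsum, Finset.mul_sum, Real.exp_sum]
  simp_rw [h1]
  rw [integral_fintype_prod_eq_prod (fun b (x : Bool) => Real.exp (l * (sgn x * a b)))]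
  have h2 : ∀ b, ∫ x, Real.exp (l * (sgn x * a b)) ∂coin = Real.cosh (l * a b) := fun b => by
    rw [integral_coin, Real.cosh_eq]; simp [sgn]
  simp_rw [h2]
  calc ∏ b, Real.cosh (l * a b) ≤ ∏ b, Real.exp ((l * a b) ^ 2 / 2) :=
        Finset.prod_le_prod (fun b _ => (Real.cosh_pos _).le) fun b _ => Real.cosh_le_exp_half_sq _
    _ = _ := by
        rw [← Real.exp_sum, Finset.mul_sum, Finset.sum_div]
        congr 1; exact Finset.sum_congr rfl fun b _ => by ring

theorem rsum_upper_tail (a : β → ℝ) {τ : ℝ} (hτ : 0 ≤ τ) :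
    (coins β).real {r | √(2 * τ * ∑ b, a b ^ 2) < rsum a r} ≤ Real.exp (-τ) := by
  set A := ∑ b, a b ^ 2 with hA
  have hA0 : 0 ≤ A := Finset.sum_nonneg fun b _ => sq_nonneg _
  rcases hA0.eq_or_lt with h0 | hpos
  · have hw : ∀ b, a b = 0 := fun b => by
      have := (Finset.sum_eq_zero_iff_of_nonneg (fun i _ => sq_nonneg (a i))).1 h0.symm b
        (Finset.mem_univ b)
      simpa using this
    simp [rsum, hw, ← h0, Real.exp_nonneg]
  set s : ℝ := √(2 * τ / A)
  have hch := measure_ge_le_exp_mul_mgf (μ := coins β) (X := rsum a) (t := s) (√(2 * τ * A))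
    (Real.sqrt_nonneg _) Integrable.of_finite
  have hs2 : s ^ 2 = 2 * τ / A := Real.sq_sqrt (by positivity)
  have hsA : s * √(2 * τ * A) = 2 * τ := by
    rw [← Real.sqrt_mul (by positivity), show 2 * τ / A * (2 * τ * A) = (2 * τ) ^ 2 by
      field_simp, Real.sqrt_sq (by positivity)]
  calc (coins β).real {r | √(2 * τ * A) < rsum a r}
      ≤ (coins β).real {r | √(2 * τ * A) ≤ rsum a r} :=
        measureReal_mono fun r hr => by
          simp only [Set.mem_ofPred_eq] at hr ⊢
          exact hr.le
    _ ≤ _ := hch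
    _ ≤ Real.exp (-s * √(2 * τ * A)) * Real.exp (s ^ 2 * A / 2) := by
        gcongr
        exact integral_exp_mul_rsum_le a s
    _ = Real.exp (-τ) := by
        rw [← Real.exp_add]
        congr 1
        rw [hs2, neg_mul, hsA]
        field_simp
        ring

/-- Hoeffding's inequality for Rademacher sums. -/
theorem rsum_sq_tail (a : β → ℝ) {τ : ℝ} (hτ : 0 ≤ τ) :
    (coins β).real {r | 2 * τ * ∑ b, a b ^ 2 < rsum a r ^ 2} ≤ 2 * Real.exp (-τ) := by
  have h1 := rsum_upper_tail a hτ
  have h2 := rsum_upper_tail (fun b => - a b) hτ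
  rw [two_mul (Real.exp _)]
  refine (measureReal_mono ?_).trans ((measureReal_union_le _ _).trans (add_le_add h1 h2))
  intro r hr
  have hr' := Real.sqrt_lt_sqrt
    (mul_nonneg (by positivity) (Finset.sum_nonneg fun b _ => sq_nonneg (a b))) hr
  rw [Real.sqrt_sq_eq_abs, lt_abs] at hr'
  simpa [rsum] using hr'

/-- Hoeffding's inequality for Rademacher sums with complex coefficients. -/
theorem rsum_complex_tail (a : β → ℂ) {τ : ℝ} (hτ : 0 ≤ τ) :
    (coins β).real {r | 2 * τ * ∑ b, ‖a b‖ ^ 2 < ‖∑ b, (sgn (r b) : ℂ) * a b‖ ^ 2} ≤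
      4 * Real.exp (-τ) := by
  have h1 := rsum_sq_tail (fun b => (a b).re) hτ
  have h2 := rsum_sq_tail (fun b => (a b).im) hτ
  refine (measureReal_mono (?_ : _ ⊆ {r | 2 * τ * ∑ b, (a b).re ^ 2 < rsum (fun b => (a b).re) r ^ 2}
    ∪ {r | 2 * τ * ∑ b, (a b).im ^ 2 < rsum (fun b => (a b).im) r ^ 2})).trans
    ((measureReal_union_le _ _).trans ((add_le_add h1 h2).trans_eq (by ring)))
  intro r hr
  by_contra hcon
  simp only [Set.mem_union, Set.mem_ofPred_eq, not_or, not_lt] at hcon hr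
  have e1 : ∀ z : ℂ, ‖z‖ ^ 2 = z.re ^ 2 + z.im ^ 2 := fun z => by
    rw [Complex.sq_norm, Complex.normSq_apply]; ring
  simp only [e1, Finset.sum_add_distrib, Complex.re_sum, Complex.im_sum, Complex.re_ofReal_mul,
    Complex.im_ofReal_mul] at hr
  simp only [rsum] at hcon
  linarith [hcon.1, hcon.2]

theorem integral_rsum_sq (a : β → ℝ) : ∫ r, rsum a r ^ 2 ∂(coins β) = ∑ b, a b ^ 2 := by
  classical
  have hvar := variance_sum_pi (μ := fun _ : β => coin) (X := fun b x => sgn x * a b)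
    (fun b => MemLp.of_discrete)
  have hmean : ∫ r, rsum a r ∂(coins β) = 0 := by
    simp only [rsum]
    rw [integral_finsetSum _ fun b _ => Integrable.of_finite]
    refine Finset.sum_eq_zero fun b _ => ?_
    rw [integral_comp_eval (μ := fun _ : β => coin) (i := b) (f := fun x => sgn x * a b)
      (Measurable.of_discrete.aestronglyMeasurable), integral_coin]
    simp [sgn]
  have e : (∑ b, fun r : β → Bool => sgn (r b) * a b) = rsum a := by
    funext r; simp [rsum]
  rw [e, variance_of_integral_eq_zero Measurable.of_discrete.aemeasurable hmean] at hvar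
  rw [hvar]
  refine Finset.sum_congr rfl fun b _ => ?_
  rw [variance_of_integral_eq_zero Measurable.of_discrete.aemeasurable (by
    rw [integral_coin]; simp [sgn]), integral_coin]
  simp [sgn]

theorem integral_exp_sq_quarter_gaussian :
    ∫ g, Real.exp (g ^ 2 / 4) ∂(gaussianReal 0 1) = √2 := by
  rw [integral_gaussianReal_eq_integral_smul one_ne_zero]
  have h : ∀ g : ℝ, gaussianPDFReal 0 1 g • Real.exp (g ^ 2 / 4)
      = (√(2 * Real.pi))⁻¹ * Real.exp (-(1 / 4) * g ^ 2) := fun g => by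
    simp only [gaussianPDFReal, smul_eq_mul, NNReal.coe_one, mul_one, sub_zero]
    rw [mul_assoc, ← Real.exp_add]
    congr 2
    ring
  simp_rw [h]
  rw [integral_const_mul, integral_gaussian, ← Real.sqrt_inv, ← Real.sqrt_mul (by positivity)]
  congr 1
  have := Real.pi_ne_zero
  field_simp
  norm_num

/-- A Rademacher sum divided by its standard deviation has a subgaussian square. With a standard
Gaussian `g` independent of the signs, `exp (S² / (4 A))` is the mean of `exp (g S / √(2 A))` over
`g`, and the two averages may be taken in the other order. -/
theorem integral_exp_rsum_sq_le (a : β → ℝ) :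
    ∫ r, Real.exp (rsum a r ^ 2 / (2 * ∑ b, a b ^ 2) / 2) ∂(coins β) ≤ 4 := by
  set A := ∑ b, a b ^ 2 with hA
  have hA0 : 0 ≤ A := Finset.sum_nonneg fun b _ => sq_nonneg _
  rcases hA0.eq_or_lt with h0 | hpos
  · simp [← h0]
  set θ : ℝ := (√(2 * A))⁻¹
  have hθ : θ ^ 2 = 1 / (2 * A) := by
    rw [inv_pow, Real.sq_sqrt (by positivity), one_div]
  have hlin : ∀ r : β → Bool, Real.exp (rsum a r ^ 2 / (2 * A) / 2)
      = ∫ g, Real.exp (θ * rsum a r * g) ∂(gaussianReal 0 1) := fun r => by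
    have := congrFun (mgf_fun_id_gaussianReal (μ := 0) (v := 1)) (θ * rsum a r)
    rw [mgf] at this
    rw [this, mul_pow, hθ]
    congr 1
    simp
    ring
  have hgi : Integrable (fun g : ℝ => Real.exp (g ^ 2 / 4)) (gaussianReal 0 1) := by
    refine Integrable.of_integral_ne_zero ?_
    rw [integral_exp_sq_quarter_gaussian]
    positivity
  have hswap : ∫ r, ∫ g, Real.exp (θ * rsum a r * g) ∂(gaussianReal 0 1) ∂(coins β)
      = ∫ g, ∫ r, Real.exp (θ * rsum a r * g) ∂(coins β) ∂(gaussianReal 0 1) := by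
    classical
    rw [integral_fintype Integrable.of_finite]
    simp_rw [integral_fintype (μ := coins β) Integrable.of_finite]
    simp_rw [smul_eq_mul]
    rw [integral_finsetSum _ fun r _ => (integrable_exp_mul_gaussianReal _).const_mul _]
    simp_rw [integral_const_mul]
  simp_rw [hlin]
  rw [hswap]
  calc ∫ g, ∫ r, Real.exp (θ * rsum a r * g) ∂(coins β) ∂(gaussianReal 0 1)
      ≤ ∫ g, Real.exp (g ^ 2 / 4) ∂(gaussianReal 0 1) := by
        refine integral_mono_of_nonneg (ae_of_all _ fun g => integral_nonneg fun r =>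
          Real.exp_nonneg _) hgi (ae_of_all _ fun g => ?_)
        have h1 := integral_exp_mul_rsum_le a (θ * g)
        have h2 : (θ * g) ^ 2 * (∑ b, a b ^ 2) / 2 = g ^ 2 / 4 := by
          rw [← hA, mul_pow, hθ]; field_simp; ring
        rw [h2] at h1
        simpa only [mul_right_comm] using h1
    _ = √2 := integral_exp_sq_quarter_gaussian
    _ ≤ 4 := by
        rw [Real.sqrt_le_left (by norm_num)]; norm_num

end Rademacher

section Chaos

variable {α β : Type*} [Fintype α] [Fintype β]

/-- The sum of the squares of independent Rademacher sums concentrates around the sum of its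
conditional variances. -/
theorem real_chaos_tail (v : α → β → ℝ) {τ : ℝ} (hτ : 1 ≤ τ) :
    (Measure.pi fun _ : α => coins β).real
      {r | 72 * τ * √(∑ a, (∑ b, v a b ^ 2) ^ 2) <
        |∑ a, (rsum (v a) (r a) ^ 2 - ∑ b, v a b ^ 2)|} ≤ 2 * Real.exp (-τ) := by
  set A : α → ℝ := fun a => ∑ b, v a b ^ 2 with hA
  have hA0 : ∀ a, 0 ≤ A a := fun a => Finset.sum_nonneg fun b _ => sq_nonneg _
  -- When `A a = 0` this quotient is `0`, which is harmless: its weight `2 * A a` and the sum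
  -- `rsum (v a)` vanish too.
  set Y : α → (β → Bool) → ℝ := fun a s => rsum (v a) s ^ 2 / (2 * A a) with hY
  have hY0 : ∀ a s, 0 ≤ Y a s := fun a s => by have := hA0 a; positivity
  have hYm : ∀ a, Measurable (Y a) := fun a => Measurable.of_discrete
  have hmean : ∀ a, 2 * A a * ∫ s, Y a s ∂(coins β) = A a := fun a => by
    simp only [hY]
    rw [integral_div, integral_rsum_sq]
    change 2 * A a * (A a / (2 * A a)) = A a
    rcases (hA0 a).eq_or_lt with h0 | hpos
    · rw [← h0]; simp
    · field_simp
  have hval : ∀ a s, 2 * A a * Y a s = rsum (v a) s ^ 2 := fun a s => by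
    simp only [hY]
    rcases (hA0 a).eq_or_lt with h0 | hpos
    · have hz : ∀ b, v a b = 0 := fun b => by
        have := (Finset.sum_eq_zero_iff_of_nonneg (fun b _ => sq_nonneg (v a b))).1 h0.symm b
          (Finset.mem_univ b)
        simpa using this
      simp [rsum, hz]
    · field_simp
  have heval : ∀ (a : α) (g : (β → Bool) → ℝ),
      ∫ r, g (r a) ∂(Measure.pi fun _ : α => coins β) = ∫ s, g s ∂(coins β) := fun a g =>
    integral_comp_eval (μ := fun _ : α => coins β) (i := a)
      Measurable.of_discrete.aestronglyMeasurable
  have h := subexponential_tail (P := Measure.pi fun _ : α => coins β)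
    (Y := fun a r => Y a (r a)) (fun a => (hYm a).comp (measurable_pi_apply a))
    (fun a r => hY0 a _) (iIndepFun_pi fun a => (hYm a).aemeasurable)
    (fun a => Integrable.of_finite)
    (fun a => by
      rw [heval a fun s => Real.exp (Y a s / 2)]
      exact integral_exp_rsum_sq_le (v a)) (fun a => 2 * A a) hτ
  have hnorm : √(∑ a, (2 * A a) ^ 2) = 2 * √(∑ a, A a ^ 2) := by
    simp_rw [mul_pow]
    rw [← Finset.mul_sum, Real.sqrt_mul (by norm_num), Real.sqrt_sq (by norm_num)]
  refine le_trans (le_of_eq ?_) h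
  congr 1
  ext r
  simp only [Set.mem_ofPred_eq, hnorm, heval, mul_sub, hmean, hval]
  rw [show 36 * τ * (2 * √(∑ a, A a ^ 2)) = 72 * τ * √(∑ a, A a ^ 2) by ring]

/-- The complex version of `real_chaos_tail`, obtained from real and imaginary parts. -/
theorem complex_chaos_tail (v : α → β → ℂ) {τ : ℝ} (hτ : 1 ≤ τ) :
    (Measure.pi fun _ : α => coins β).real
      {r | 144 * τ * √(∑ a, (∑ b, ‖v a b‖ ^ 2) ^ 2) <
        |∑ a, (‖∑ b, (sgn (r a b) : ℂ) * v a b‖ ^ 2 - ∑ b, ‖v a b‖ ^ 2)|} ≤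
      4 * Real.exp (-τ) := by
  have h1 := real_chaos_tail (fun a b => (v a b).re) hτ
  have h2 := real_chaos_tail (fun a b => (v a b).im) hτ
  refine (measureReal_mono (?_ : _ ⊆ {r : α → β → Bool | 72 * τ * √(∑ a, (∑ b, (v a b).re ^ 2) ^ 2) <
        |∑ a, (rsum (fun b => (v a b).re) (r a) ^ 2 - ∑ b, (v a b).re ^ 2)|}
    ∪ {r : α → β → Bool | 72 * τ * √(∑ a, (∑ b, (v a b).im ^ 2) ^ 2) <
        |∑ a, (rsum (fun b => (v a b).im) (r a) ^ 2 - ∑ b, (v a b).im ^ 2)|})).trans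
    ((measureReal_union_le _ _).trans ((add_le_add h1 h2).trans_eq (by ring)))
  intro r hr
  by_contra hcon
  simp only [Set.mem_union, Set.mem_ofPred_eq, not_or, not_lt] at hcon hr
  obtain ⟨hc1, hc2⟩ := hcon
  have e1 : ∀ z : ℂ, ‖z‖ ^ 2 = z.re ^ 2 + z.im ^ 2 := fun z => by
    rw [Complex.sq_norm, Complex.normSq_apply]; ring
  have e2 : ∀ a, ‖∑ b, (sgn (r a b) : ℂ) * v a b‖ ^ 2 =
      rsum (fun b => (v a b).re) (r a) ^ 2 + rsum (fun b => (v a b).im) (r a) ^ 2 := fun a => by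
    simp [e1, rsum, Complex.re_sum, Complex.im_sum]
  have e3 : ∑ a, (‖∑ b, (sgn (r a b) : ℂ) * v a b‖ ^ 2 - ∑ b, ‖v a b‖ ^ 2) =
      ∑ a, (rsum (fun b => (v a b).re) (r a) ^ 2 - ∑ b, (v a b).re ^ 2) +
      ∑ a, (rsum (fun b => (v a b).im) (r a) ^ 2 - ∑ b, (v a b).im ^ 2) := by
    rw [← Finset.sum_add_distrib]
    refine Finset.sum_congr rfl fun a _ => ?_
    rw [e2, Finset.sum_congr rfl fun b _ => e1 (v a b), Finset.sum_add_distrib]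
    ring
  have m1 : √(∑ a, (∑ b, (v a b).re ^ 2) ^ 2) ≤ √(∑ a, (∑ b, ‖v a b‖ ^ 2) ^ 2) := by
    refine Real.sqrt_le_sqrt (Finset.sum_le_sum fun a _ => pow_le_pow_left₀
      (Finset.sum_nonneg fun b _ => sq_nonneg _) (Finset.sum_le_sum fun b _ => ?_) 2)
    rw [e1]; nlinarith [sq_nonneg (v a b).im]
  have m2 : √(∑ a, (∑ b, (v a b).im ^ 2) ^ 2) ≤ √(∑ a, (∑ b, ‖v a b‖ ^ 2) ^ 2) := by
    refine Real.sqrt_le_sqrt (Finset.sum_le_sum fun a _ => pow_le_pow_left₀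
      (Finset.sum_nonneg fun b _ => sq_nonneg _) (Finset.sum_le_sum fun b _ => ?_) 2)
    rw [e1]; nlinarith [sq_nonneg (v a b).re]
  rw [e3] at hr
  have := abs_add_le (∑ a, (rsum (fun b => (v a b).re) (r a) ^ 2 - ∑ b, (v a b).re ^ 2))
    (∑ a, (rsum (fun b => (v a b).im) (r a) ^ 2 - ∑ b, (v a b).im ^ 2))
  nlinarith

end Chaos

/-! ### The circularly symmetric Gaussian law -/

instance (v : ℝ≥0) : IsProbabilityMeasure (circGaussian v) :=
  Measure.isProbabilityMeasure_map
    (Complex.measurableEquivRealProd.symm.measurable.aemeasurable)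

theorem circGaussian_eq_map (v : ℝ≥0) :
    circGaussian v = ((gaussianReal 0 (v / 2)).prod (gaussianReal 0 (v / 2))).map
      Complex.measurableEquivRealProd.symm := rfl

/-- The law `circGaussian 1` has density `exp (-‖z‖ ^ 2) / π`. -/
theorem integral_circGaussian (g : ℂ → ℝ) :
    ∫ z, g z ∂(circGaussian 1) = Real.pi⁻¹ * ∫ z, Real.exp (-‖z‖ ^ 2) * g z := by
  have hv : (1 / 2 : ℝ≥0) ≠ 0 := by norm_num
  rw [circGaussian_eq_map, integral_map_equiv, gaussianReal_of_var_ne_zero _ hv,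
    prod_withDensity (measurable_gaussianPDF _ _) (measurable_gaussianPDF _ _),
    integral_withDensity_eq_integral_toReal_smul (by fun_prop)
      (ae_of_all _ fun p => ENNReal.mul_lt_top gaussianPDF_lt_top gaussianPDF_lt_top),
    ← integral_const_mul,
    ← Complex.volume_preserving_equiv_real_prod.symm.integral_comp'
      (g := fun z => Real.pi⁻¹ * (Real.exp (-‖z‖ ^ 2) * g z))]
  refine integral_congr_ae (ae_of_all _ fun p => ?_)
  have hn : ‖Complex.measurableEquivRealProd.symm p‖ ^ 2 = p.1 ^ 2 + p.2 ^ 2 := by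
    rw [Complex.sq_norm, Complex.normSq_apply]
    simp
    ring
  simp only [ENNReal.toReal_mul, toReal_gaussianPDF, smul_eq_mul, hn, gaussianPDFReal]
  rw [← mul_assoc, ← mul_assoc]
  congr 1
  have h1 : (√(2 * Real.pi * ((1 / 2 : ℝ≥0) : ℝ)))⁻¹ * (√(2 * Real.pi * ((1 / 2 : ℝ≥0) : ℝ)))⁻¹
      = Real.pi⁻¹ := by
    rw [← mul_inv, Real.mul_self_sqrt (by positivity)]
    congr 1
    push_cast
    ring
  rw [show ∀ a b d : ℝ, a * b * a * d = a * a * (b * d) from fun a b d => by ring, h1,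
    ← Real.exp_add]
  congr 2
  push_cast
  ring

theorem integral_norm_circGaussian : ∫ z, ‖z‖ ∂(circGaussian 1) = √Real.pi / 2 := by
  rw [integral_circGaussian]
  have h := Complex.integral_rpow_mul_exp_neg_rpow (p := 2) (q := 1) (by norm_num) (by norm_num)
  have h2 : (∫ z : ℂ, Real.exp (-‖z‖ ^ 2) * ‖z‖) = Real.pi * (√Real.pi / 2) := by
    rw [show Real.pi * (√Real.pi / 2) = 2 * Real.pi / 2 * Real.Gamma ((1 + 2) / 2) by
      rw [show ((1 : ℝ) + 2) / 2 = 1 / 2 + 1 by norm_num, Real.Gamma_add_one (by norm_num),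
        Real.Gamma_one_half_eq]
      ring, ← h]
    refine integral_congr_ae (ae_of_all _ fun z => ?_)
    simp [mul_comm]
  rw [h2]
  have := Real.pi_ne_zero
  field_simp

theorem integral_norm_sq_circGaussian : ∫ z, ‖z‖ ^ 2 ∂(circGaussian 1) = 1 := by
  rw [integral_circGaussian]
  have h := Complex.integral_rpow_mul_exp_neg_rpow (p := 2) (q := 2) (by norm_num) (by norm_num)
  have h2 : (∫ z : ℂ, Real.exp (-‖z‖ ^ 2) * ‖z‖ ^ 2) = Real.pi := by
    rw [show ((2 : ℝ) + 2) / 2 = 1 + 1 by norm_num, Real.Gamma_add_one (by norm_num),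
        Real.Gamma_one] at h
    rw [show Real.pi = 2 * Real.pi / 2 * (1 * 1) by ring, ← h]
    refine integral_congr_ae (ae_of_all _ fun z => ?_)
    simp [mul_comm]
  rw [h2]
  exact inv_mul_cancel₀ Real.pi_ne_zero

theorem integral_exp_norm_sq_circGaussian :
    ∫ z, Real.exp (‖z‖ ^ 2 / 2) ∂(circGaussian 1) = 2 := by
  rw [integral_circGaussian]
  have h := Complex.integral_exp_neg_mul_rpow (p := 2) (b := 1 / 2) (by norm_num) (by norm_num)
  have h2 : (∫ z : ℂ, Real.exp (-‖z‖ ^ 2) * Real.exp (‖z‖ ^ 2 / 2)) = Real.pi * 2 := by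
    rw [show (2 : ℝ) / 2 + 1 = 1 + 1 by norm_num, Real.Gamma_add_one (by norm_num),
        Real.Gamma_one, show (-2 : ℝ) / 2 = -1 by norm_num, Real.rpow_neg_one] at h
    rw [show Real.pi * 2 = Real.pi * (1 / 2)⁻¹ * (1 * 1) by norm_num, ← h]
    refine integral_congr_ae (ae_of_all _ fun z => ?_)
    simp only [← Real.exp_add, Real.rpow_two]
    congr 1
    ring
  rw [h2]
  have := Real.pi_ne_zero
  field_simp

theorem integrable_exp_norm_sq_circGaussian :
    Integrable (fun z : ℂ => Real.exp (‖z‖ ^ 2 / 2)) (circGaussian 1) :=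
  Integrable.of_integral_ne_zero (by rw [integral_exp_norm_sq_circGaussian]; norm_num)

/-- Chernoff's bound at the exponent `1 / 2`. -/
theorem circGaussian_tail (τ : ℝ) :
    (circGaussian 1).real {z | 2 * τ < ‖z‖ ^ 2} ≤ 2 * Real.exp (-τ) := by
  have h := measure_ge_le_exp_mul_mgf (μ := circGaussian 1) (X := fun z : ℂ => ‖z‖ ^ 2)
    (t := 1 / 2) (2 * τ) (by norm_num)
    (by simpa [div_eq_inv_mul] using integrable_exp_norm_sq_circGaussian)
  have h2 : mgf (fun z : ℂ => ‖z‖ ^ 2) (circGaussian 1) (1 / 2) = 2 := by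
    simpa [mgf, div_eq_inv_mul] using integral_exp_norm_sq_circGaussian
  rw [h2, show -(1 / 2) * (2 * τ) = -τ by ring, mul_comm (Real.exp _)] at h
  refine (measureReal_mono ?_ (measure_ne_top _ _)).trans h
  intro z hz
  simp only [Set.mem_ofPred_eq] at hz ⊢
  exact hz.le

theorem circGaussian_ae_ne_zero : ∀ᵐ z ∂(circGaussian 1), z ≠ 0 := by
  have hv : (1 / 2 : ℝ≥0) ≠ 0 := by norm_num
  have hm : MeasurableSet {z : ℂ | z ≠ 0} := (measurableSet_singleton 0).compl
  have := nullSingletonClass_gaussianReal (μ := 0) hv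
  rw [circGaussian_eq_map, ae_map_iff Complex.measurableEquivRealProd.symm.measurable.aemeasurable hm]
  have h1 : ∀ᵐ x ∂(gaussianReal 0 (1 / 2)), x ≠ 0 := by
    simp only [ae_iff, not_not, Set.ofPred_eq_eq_singleton]
    exact measure_singleton 0
  have h2 := (Measure.quasiMeasurePreserving_fst
    (μ := gaussianReal 0 (1 / 2)) (ν := gaussianReal 0 (1 / 2))).ae h1
  filter_upwards [h2] with p hp h0
  exact hp (congrArg Complex.re h0)

theorem circGaussian_map_sgn (b : Bool) :
    MeasurePreserving (fun z : ℂ => (sgn b : ℂ) * z) (circGaussian 1) (circGaussian 1) := by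
  cases b
  · refine ⟨by fun_prop, ?_⟩
    have h1 : (fun z : ℂ => (sgn false : ℂ) * z) = fun z => -z := by funext z; simp [sgn]
    have hm := Complex.measurableEquivRealProd.symm.measurable
    have h2 : (fun z : ℂ => -z) ∘ Complex.measurableEquivRealProd.symm
        = Complex.measurableEquivRealProd.symm ∘ Prod.map (fun x => -x) (fun x => -x) := by
      funext p; apply Complex.ext <;> simp
    rw [h1, circGaussian_eq_map, Measure.map_map measurable_neg hm, h2, ← Measure.map_map hm
      (by fun_prop), ← Measure.map_prod_map _ _ measurable_neg measurable_neg,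
      gaussianReal_map_neg, neg_zero]
  · have h1 : (fun z : ℂ => (sgn true : ℂ) * z) = id := by funext z; simp [sgn]
    rw [h1]
    exact MeasurePreserving.id _

/-! ### Symmetrisation -/

/-- Index of all channel coefficients: first the sources-to-relays ones, then the
relays-to-destinations ones. -/
abbrev Chan (K M : ℕ) : Type := (Fin K × Fin M) ⊕ (Fin M × Fin K)

/-- The law of independent standard complex Gaussians. -/
abbrev gaussFamily (ι : Type*) [Fintype ι] : Measure (ι → ℂ) := Measure.pi fun _ => circGaussian 1

/-- The family `z` with its coordinates multiplied by the signs `e`. -/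
def flipSigns {ι : Type*} (e : ι → Bool) (z : ι → ℂ) : ι → ℂ := fun i => (sgn (e i) : ℂ) * z i

/-- An event about independent symmetric variables has the probability of its randomly signed
version; it is therefore enough to bound the latter for fixed values of the variables. -/
theorem measureReal_le_of_flip {ι S : Type*} [Fintype ι] [Finite S] [MeasurableSpace S]
    [MeasurableSingletonClass S] (ν : Measure S) [IsProbabilityMeasure ν] (e : S → ι → Bool)
    {A : Set (ι → ℂ)} (hA : MeasurableSet A) {p : ℝ}
    (h : ∀ᵐ z ∂(gaussFamily ι), ν.real {s | flipSigns (e s) z ∈ A} ≤ p) :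
    (gaussFamily ι).real A ≤ p := by
  have hpres : ∀ s, MeasurePreserving (flipSigns (e s)) (gaussFamily ι) (gaussFamily ι) := fun s =>
    measurePreserving_pi _ _ fun i => circGaussian_map_sgn (e s i)
  have hp : 0 ≤ p := by
    obtain ⟨z, hz⟩ := h.exists
    exact measureReal_nonneg.trans hz
  have hmeas : Measurable fun q : S × (ι → ℂ) => flipSigns (e q.1) q.2 :=
    measurable_from_prod_countable_right fun s => (hpres s).measurable
  have hB : MeasurableSet {q : S × (ι → ℂ) | flipSigns (e q.1) q.2 ∈ A} := hmeas hA
  have h1 : (ν.prod (gaussFamily ι)) {q | flipSigns (e q.1) q.2 ∈ A} = gaussFamily ι A := by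
    rw [Measure.prod_apply hB]
    have : ∀ s, gaussFamily ι (Prod.mk s ⁻¹' {q : S × (ι → ℂ) | flipSigns (e q.1) q.2 ∈ A})
        = gaussFamily ι A := fun s => (hpres s).measure_preimage hA.nullMeasurableSet
    simp_rw [this]
    simp
  have h2 : (ν.prod (gaussFamily ι)) {q | flipSigns (e q.1) q.2 ∈ A} ≤ ENNReal.ofReal p := by
    rw [Measure.prod_apply_symm hB]
    calc _ ≤ ∫⁻ _, ENNReal.ofReal p ∂(gaussFamily ι) := by
          refine lintegral_mono_ae ?_
          filter_upwards [h] with z hz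
          exact (ENNReal.le_ofReal_iff_toReal_le (measure_ne_top _ _) hp).2 hz
      _ = ENNReal.ofReal p := by simp
  exact (ENNReal.le_ofReal_iff_toReal_le (measure_ne_top _ _) hp).1 (h1 ▸ h2)

theorem gaussFamily_ae_ne_zero (ι : Type*) [Fintype ι] :
    ∀ᵐ z ∂(gaussFamily ι), ∀ i, z i ≠ 0 :=
  ae_all_iff.2 fun i => (measurePreserving_eval (fun _ : ι => circGaussian 1)
    i).quasiMeasurePreserving.ae circGaussian_ae_ne_zero

/-! ### Cophasing -/

/-- The factor by which a relay multiplies in order to undo the phase of `z`. -/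
def cophase (z : ℂ) : ℂ := conj (phase z)

@[fun_prop]
theorem measurable_cophase : Measurable cophase := by
  unfold cophase phase
  exact Complex.continuous_conj.measurable.comp (by fun_prop)

theorem norm_cophase (z : ℂ) : ‖cophase z‖ = 1 := by
  rw [cophase, Complex.norm_conj, phase, mul_comm, Complex.norm_exp_ofReal_mul_I]

theorem phase_mul_norm (z : ℂ) : phase z * ‖z‖ = z := by
  rw [phase, mul_comm Complex.I, mul_comm]
  exact Complex.norm_mul_exp_arg_mul_I z

theorem cophase_mul_self (z : ℂ) : cophase z * z = ‖z‖ := by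
  have h1 : cophase z * phase z = 1 := by
    rw [cophase, ← Complex.normSq_eq_conj_mul_self, Complex.normSq_eq_norm_sq, ← Complex.norm_conj,
      ← cophase, norm_cophase]
    simp
  calc cophase z * z = cophase z * (phase z * ‖z‖) := by rw [phase_mul_norm]
    _ = ‖z‖ := by rw [← mul_assoc, h1, one_mul]

theorem norm_sgn (b : Bool) : ‖(sgn b : ℂ)‖ = 1 := by cases b <;> simp [sgn]

theorem norm_sgn_mul (b : Bool) (z : ℂ) : ‖(sgn b : ℂ) * z‖ = ‖z‖ := by
  rw [norm_mul, norm_sgn, one_mul]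

theorem sgn_true : sgn true = 1 := rfl

/-- At `z = 0` the phase is `1`, whatever the sign, so this fails there. -/
theorem cophase_sgn_mul (b : Bool) {z : ℂ} (hz : z ≠ 0) :
    cophase ((sgn b : ℂ) * z) = (sgn b : ℂ) * cophase z := by
  have h1 := cophase_mul_self ((sgn b : ℂ) * z)
  rw [norm_sgn_mul, ← cophase_mul_self z] at h1
  have h2 : (sgn b : ℂ) * (sgn b : ℂ) = 1 := by exact_mod_cast sgn_mul_self b
  refine mul_right_cancel₀ hz ?_
  calc cophase ((sgn b : ℂ) * z) * z
      = (sgn b : ℂ) * (cophase ((sgn b : ℂ) * z) * ((sgn b : ℂ) * z)) := by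
        linear_combination (-cophase ((sgn b : ℂ) * z) * z) * h2
    _ = (sgn b : ℂ) * cophase z * z := by rw [h1]; ring

variable {K M : ℕ}

/-- The total cophasing factor of relay `k`, over all source-destination pairs. -/
def phaseSum (z : Chan K M → ℂ) (k : Fin K) : ℂ :=
  ∑ n, cophase (z (.inr (n, k))) * cophase (z (.inl (k, n)))

@[fun_prop]
theorem measurable_phaseSum (k : Fin K) :
    Measurable fun z : Chan K M → ℂ => phaseSum z k := by
  unfold phaseSum; fun_prop

/-! ### Tail bounds for the components of the SINR -/

theorem gaussFamily_coord_tail {ι : Type*} [Fintype ι] (i : ι) (τ : ℝ) :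
    (gaussFamily ι).real {z | 2 * τ < ‖z i‖ ^ 2} ≤ 2 * Real.exp (-τ) := by
  have hm : MeasurableSet {w : ℂ | 2 * τ < ‖w‖ ^ 2} :=
    measurableSet_lt (by fun_prop) (by fun_prop)
  have h := (measurePreserving_eval (fun _ : ι => circGaussian 1) i).measureReal_preimage
    hm.nullMeasurableSet
  exact h.trans_le (circGaussian_tail τ)

/-- Flipping the sources-to-relays signs makes the cophasing factor a Rademacher sum. -/
theorem phaseSum_tail (k : Fin K) {τ : ℝ} (hτ : 0 ≤ τ) :
    (gaussFamily (Chan K M)).real {z | 2 * τ * M < ‖phaseSum z k‖ ^ 2} ≤ 4 * Real.exp (-τ) := by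
  refine measureReal_le_of_flip (coins (Fin M))
    (fun s i => Sum.elim (fun p => s p.2) (fun _ => true) i)
    (measurableSet_lt (by fun_prop) (by fun_prop)) ?_
  filter_upwards [gaussFamily_ae_ne_zero (Chan K M)] with z hz
  refine le_trans (le_of_eq ?_) (rsum_complex_tail
    (fun n : Fin M => cophase (z (.inr (n, k))) * cophase (z (.inl (k, n)))) hτ)
  congr 1
  ext s
  simp only [Set.mem_ofPred_eq, phaseSum, flipSigns, Sum.elim_inl, Sum.elim_inr,
    cophase_sgn_mul _ (hz _), norm_mul, norm_cophase, sgn_true]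
  simp [mul_left_comm]

/-- The part of the useful signal that relay `p.1` cophases for the pair `p.2 ≠ m`. -/
def crossTerm (C : Fin K → ℝ) (m : Fin M) (z : Chan K M → ℂ) (p : Fin K × Fin M) : ℂ :=
  if p.2 = m then 0 else
    (C p.1 : ℂ) * (cophase (z (.inr (p.2, p.1))) * z (.inr (m, p.1)) *
      cophase (z (.inl p)) * z (.inl (p.1, m)))

@[fun_prop]
theorem measurable_crossTerm (C : Fin K → ℝ) (m : Fin M) (p : Fin K × Fin M) :
    Measurable fun z => crossTerm C m z p := by
  unfold crossTerm
  split_ifs <;> fun_prop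

/-- Flipping the signs of the channels from the relays to the destinations `n ≠ m` makes the wrongly
cophased part of the useful signal a Rademacher sum. -/
theorem crossTerm_tail (C : Fin K → ℝ) (m : Fin M) {τ : ℝ} (hτ : 0 ≤ τ) :
    (gaussFamily (Chan K M)).real {z | 2 * τ * ∑ p, ‖crossTerm C m z p‖ ^ 2 <
      ‖∑ p, crossTerm C m z p‖ ^ 2} ≤ 4 * Real.exp (-τ) := by
  refine measureReal_le_of_flip (coins (Fin K × Fin M))
    (fun s i => Sum.elim (fun _ => true) (fun p => if p.1 = m then true else s (p.2, p.1)) i)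
    (measurableSet_lt (by fun_prop) (by fun_prop)) ?_
  filter_upwards [gaussFamily_ae_ne_zero (Chan K M)] with z hz
  have hflip : ∀ (s : Fin K × Fin M → Bool) p, crossTerm C m (flipSigns (fun i => Sum.elim
      (fun _ => true) (fun p => if p.1 = m then true else s (p.2, p.1)) i) z) p
      = (sgn (s p) : ℂ) * crossTerm C m z p := fun s p => by
    unfold crossTerm
    split_ifs with h
    · simp
    · simp only [flipSigns, Sum.elim_inl, Sum.elim_inr, cophase_sgn_mul _ (hz _), h, if_true, if_false,
        sgn_true]
      push_cast
      ring_nf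
  refine le_trans (le_of_eq ?_) (rsum_complex_tail (crossTerm C m z) hτ)
  congr 1
  ext s
  simp only [Set.mem_ofPred_eq, hflip, norm_sgn_mul]

/-- The signal of source `m'` received by destination `m` through relay `k`, with gain `W k m'`. -/
def relayed (W : Fin K → Fin M → ℝ) (m : Fin M) (z : Chan K M → ℂ) (m' : Fin M) (k : Fin K) : ℂ :=
  (W k m' : ℂ) * (z (.inr (m, k)) * phaseSum z k * z (.inl (k, m')))

@[fun_prop]
theorem measurable_relayed (W : Fin K → Fin M → ℝ) (m m' : Fin M) (k : Fin K) :
    Measurable fun z => relayed W m z m' k := by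
  unfold relayed; fun_prop

/-- Flipping the signs of both channels of a pair `n` at a relay leaves the cophasing factors
unchanged; doing so for all `n ≠ m` gives independent signs to all the interfering signals. -/
theorem interference_tail (W : Fin K → Fin M → ℝ) (m : Fin M) (hW : ∀ k, W k m = 0) {τ : ℝ}
    (hτ : 1 ≤ τ) :
    (gaussFamily (Chan K M)).real
      {z | 144 * τ * √(∑ m', (∑ k, ‖relayed W m z m' k‖ ^ 2) ^ 2) <
        |∑ m', (‖∑ k, relayed W m z m' k‖ ^ 2 - ∑ k, ‖relayed W m z m' k‖ ^ 2)|} ≤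
      4 * Real.exp (-τ) := by
  set e : (Fin M → Fin K → Bool) → Chan K M → Bool := fun s i => Sum.elim
    (fun p => if p.2 = m then true else s p.2 p.1)
    (fun p => if p.1 = m then true else s p.1 p.2) i with he
  refine measureReal_le_of_flip (Measure.pi fun _ : Fin M => coins (Fin K)) e
    (measurableSet_lt (by fun_prop) (by fun_prop)) ?_
  filter_upwards [gaussFamily_ae_ne_zero (Chan K M)] with z hz
  have hphase : ∀ s k, phaseSum (flipSigns (e s) z) k = phaseSum z k := fun s k => by
    unfold phaseSum
    refine Finset.sum_congr rfl fun n _ => ?_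
    have h2 : (sgn (e s (.inr (n, k))) : ℂ) * (sgn (e s (.inl (k, n))) : ℂ) = 1 := by
      exact_mod_cast sgn_mul_self _
    simp only [flipSigns, cophase_sgn_mul _ (hz _)]
    linear_combination cophase (z (.inr (n, k))) * cophase (z (.inl (k, n))) * h2
  have hflip : ∀ s m' k, relayed W m (flipSigns (e s) z) m' k
      = (sgn (s m' k) : ℂ) * relayed W m z m' k := fun s m' k => by
    unfold relayed
    rw [hphase]
    by_cases h : m' = m
    · simp [h, hW]
    · simp only [flipSigns, he, Sum.elim_inl, Sum.elim_inr, h, if_true, if_false, sgn_true]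
      push_cast
      ring
  refine le_trans (le_of_eq ?_) (complex_chaos_tail (relayed W m z) hτ)
  congr 1
  ext s
  simp only [Set.mem_ofPred_eq, hflip, norm_sgn_mul]

/-- The cophasing power `‖phaseSum z k‖ ^ 2` averages to `M` over the relays, for any weights
depending only on the moduli of the channels. -/
theorem phaseSum_sq_tail (w : (Chan K M → ℂ) → Fin K → ℝ) (hw0 : ∀ z k, 0 ≤ w z k)
    (hwm : ∀ k, Measurable fun z => w z k) (hwflip : ∀ e z, w (flipSigns e z) = w z) {τ : ℝ}
    (hτ : 1 ≤ τ) :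
    (gaussFamily (Chan K M)).real
      {z | 144 * τ * √(∑ k, (M * w z k) ^ 2) <
        |∑ k, w z k * (‖phaseSum z k‖ ^ 2 - M)|} ≤ 4 * Real.exp (-τ) := by
  refine measureReal_le_of_flip (Measure.pi fun _ : Fin K => coins (Fin M))
    (fun s i => Sum.elim (fun p => s p.1 p.2) (fun _ => true) i)
    (measurableSet_lt (by fun_prop) (by fun_prop)) ?_
  filter_upwards [gaussFamily_ae_ne_zero (Chan K M)] with z hz
  set v : Fin K → Fin M → ℂ := fun k n =>
    (√(w z k) : ℂ) * (cophase (z (.inr (n, k))) * cophase (z (.inl (k, n)))) with hv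
  have hn : ∀ k, ‖(√(w z k) : ℂ)‖ ^ 2 = w z k := fun k => by
    rw [Complex.norm_real, Real.norm_eq_abs, sq_abs, Real.sq_sqrt (hw0 z k)]
  have hvn : ∀ k n, ‖v k n‖ ^ 2 = w z k := fun k n => by
    simp only [hv, norm_mul, norm_cophase, mul_one, hn]
  have hvsum : ∀ (s : Fin K → Fin M → Bool) k, ‖∑ n, (sgn (s k n) : ℂ) * v k n‖ ^ 2
      = w z k * ‖phaseSum (flipSigns (fun i => Sum.elim (fun p => s p.1 p.2) (fun _ => true) i) z) k‖ ^ 2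
      := fun s k => by
    rw [← hn, ← mul_pow, ← norm_mul, phaseSum, Finset.mul_sum]
    refine congrArg (fun u : ℂ => ‖u‖ ^ 2) (Finset.sum_congr rfl fun n _ => ?_)
    simp only [hv, flipSigns, Sum.elim_inl, Sum.elim_inr, cophase_sgn_mul _ (hz _), sgn_true]
    push_cast
    ring_nf
  refine le_trans (le_of_eq ?_) (complex_chaos_tail v hτ)
  congr 1
  ext s
  simp only [Set.mem_ofPred_eq, hwflip, hvsum, hvn, Finset.sum_const, Finset.card_univ,
    Fintype.card_fin, nsmul_eq_mul, mul_sub, mul_comm (M : ℝ)]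

theorem integral_gaussFamily_coord {ι : Type*} [Fintype ι] (i : ι) {g : ℂ → ℝ}
    (hg : Measurable g) :
    ∫ z, g (z i) ∂(gaussFamily ι) = ∫ w, g w ∂(circGaussian 1) :=
  integral_comp_eval (μ := fun _ : ι => circGaussian 1) (i := i) hg.aestronglyMeasurable

theorem integrable_exp_norm_sq_coord {ι : Type*} [Fintype ι] (i : ι) :
    Integrable (fun z : ι → ℂ => Real.exp (‖z i‖ ^ 2 / 2)) (gaussFamily ι) :=
  (measurePreserving_eval (fun _ : ι => circGaussian 1) i).integrable_comp_of_integrable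
    integrable_exp_norm_sq_circGaussian

/-- Weighted sums of independent channel powers. -/
theorem norm_sq_sum_tail {ι κ : Type*} [Fintype ι] [Fintype κ] {g : κ → ι}
    (hg : Function.Injective g) (w : κ → ℝ) {τ : ℝ} (hτ : 1 ≤ τ) :
    (gaussFamily ι).real {z | 36 * τ * √(∑ j, w j ^ 2) <
      |∑ j, w j * (‖z (g j)‖ ^ 2 - 1)|} ≤ 2 * Real.exp (-τ) := by
  have hind : iIndepFun (fun i (z : ι → ℂ) => ‖z i‖ ^ 2) (gaussFamily ι) :=
    iIndepFun_pi (X := fun _ (w : ℂ) => ‖w‖ ^ 2) fun _ => by fun_prop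
  have h := subexponential_tail (P := gaussFamily ι)
    (Y := fun j (z : ι → ℂ) => ‖z (g j)‖ ^ 2)
    (fun j => by fun_prop) (fun j z => sq_nonneg _) (hind.precomp hg)
    (fun j => integrable_exp_norm_sq_coord (g j))
    (fun j => by
      rw [integral_gaussFamily_coord (g j) (g := fun w => Real.exp (‖w‖ ^ 2 / 2)) (by fun_prop),
        integral_exp_norm_sq_circGaussian]
      norm_num) w hτ
  have hmean : ∀ j, ∫ z, ‖z (g j)‖ ^ 2 ∂(gaussFamily ι) = 1 := fun j => by
    rw [integral_gaussFamily_coord (g j) (g := fun w => ‖w‖ ^ 2) (by fun_prop),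
      integral_norm_sq_circGaussian]
  simpa only [hmean] using h

theorem measurePreserving_gaussFamily_precomp {ι κ : Type*} [Fintype ι] [Fintype κ] {g : κ → ι}
    (hg : Function.Injective g) :
    MeasurePreserving (fun (z : ι → ℂ) j => z (g j)) (gaussFamily ι) (gaussFamily κ) := by
  have hind : iIndepFun (fun i (z : ι → ℂ) => z i) (gaussFamily ι) :=
    iIndepFun_pi (X := fun _ (w : ℂ) => w) fun _ => by fun_prop
  refine ⟨by fun_prop, ?_⟩
  rw [(hind.precomp hg).map_fun_eq_pi_map
    fun j => (measurable_pi_apply (g j)).aemeasurable]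
  congr 1
  funext j
  exact (measurePreserving_eval (fun _ : ι => circGaussian 1) (g j)).map_eq

/-- Two disjoint subfamilies of the same size form a family of independent pairs. -/
theorem measurePreserving_gaussFamily_pairs {ι κ : Type*} [Fintype ι] [Fintype κ] {g₁ g₂ : κ → ι}
    (hg : Function.Injective (Sum.elim g₁ g₂)) :
    MeasurePreserving (fun (z : ι → ℂ) k => (z (g₁ k), z (g₂ k))) (gaussFamily ι)
      (Measure.pi fun _ : κ => (circGaussian 1).prod (circGaussian 1)) :=
  (((measurePreserving_arrowProdEquivProdArrow ℂ ℂ κ (fun _ => circGaussian 1)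
    fun _ => circGaussian 1).symm _).comp
      (measurePreserving_sumPiEquivProdPi fun _ : κ ⊕ κ => circGaussian 1)).comp
    (measurePreserving_gaussFamily_precomp hg)

/-- Weighted sums of independent products of two channel amplitudes, each of mean
`(√π / 2) ^ 2 = π / 4`. -/
theorem norm_mul_norm_sum_tail (C : Fin K → ℝ) (m : Fin M) {τ : ℝ} (hτ : 1 ≤ τ) :
    (gaussFamily (Chan K M)).real {z | 36 * τ * √(∑ k, C k ^ 2) <
      |∑ k, C k * (‖z (.inr (m, k))‖ * ‖z (.inl (k, m))‖ - Real.pi / 4)|} ≤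
      2 * Real.exp (-τ) := by
  set γ := circGaussian 1
  set Q : Measure (Fin K → ℂ × ℂ) := Measure.pi fun _ => γ.prod γ with hQ
  have heval : ∀ k {g : ℂ × ℂ → ℝ}, Measurable g → ∫ p, g (p k) ∂Q = ∫ q, g q ∂(γ.prod γ) :=
    fun k g hg => integral_comp_eval (μ := fun _ : Fin K => γ.prod γ) (i := k)
      hg.aestronglyMeasurable
  have hexpint : Integrable (fun q : ℂ × ℂ => Real.exp (‖q.1‖ ^ 2 / 2) *
      Real.exp (‖q.2‖ ^ 2 / 2)) (γ.prod γ) :=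
    integrable_exp_norm_sq_circGaussian.mul_prod integrable_exp_norm_sq_circGaussian
  have hle : ∀ q : ℂ × ℂ, Real.exp (‖q.1‖ * ‖q.2‖ / 2) ≤
      Real.exp (‖q.1‖ ^ 2 / 2) * Real.exp (‖q.2‖ ^ 2 / 2) := fun q => by
    rw [← Real.exp_add]
    refine Real.exp_le_exp.2 ?_
    nlinarith [sq_nonneg (‖q.1‖ - ‖q.2‖), sq_nonneg (‖q.1‖ + ‖q.2‖)]
  have hint : Integrable (fun q : ℂ × ℂ => Real.exp (‖q.1‖ * ‖q.2‖ / 2)) (γ.prod γ) :=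
    hexpint.mono' (by fun_prop) (ae_of_all _ fun q => by
      rw [Real.norm_eq_abs, abs_of_pos (Real.exp_pos _)]; exact hle q)
  have h := subexponential_tail (P := Q)
    (Y := fun k (p : Fin K → ℂ × ℂ) => ‖(p k).1‖ * ‖(p k).2‖)
    (fun k => by fun_prop) (fun k z => by positivity)
    (iIndepFun_pi (X := fun _ (q : ℂ × ℂ) => ‖q.1‖ * ‖q.2‖) fun _ => by fun_prop)
    (fun k => (measurePreserving_eval (fun _ : Fin K => γ.prod γ) k).integrable_comp_of_integrable
      hint)
    (fun k => by
      rw [heval k (g := fun q => Real.exp (‖q.1‖ * ‖q.2‖ / 2)) (by fun_prop)]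
      refine (integral_mono hint hexpint hle).trans ?_
      rw [integral_prod_mul (fun w : ℂ => Real.exp (‖w‖ ^ 2 / 2))
        (fun w : ℂ => Real.exp (‖w‖ ^ 2 / 2)), integral_exp_norm_sq_circGaussian]
      norm_num) C hτ
  have hmean : ∀ k, ∫ p, ‖(p k).1‖ * ‖(p k).2‖ ∂Q = Real.pi / 4 := fun k => by
    rw [heval k (g := fun q => ‖q.1‖ * ‖q.2‖) (by fun_prop),
      integral_prod_mul (fun w : ℂ => ‖w‖) (fun w : ℂ => ‖w‖), integral_norm_circGaussian,
      div_mul_div_comm, Real.mul_self_sqrt Real.pi_nonneg]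
    norm_num
  simp only [hmean] at h
  have hpair := measurePreserving_gaussFamily_pairs
    (g₁ := fun k : Fin K => (.inr (m, k) : Chan K M)) (g₂ := fun k => .inl (k, m)) (by
      rintro (a | a) (b | b) <;> simp)
  have hm : MeasurableSet {p : Fin K → ℂ × ℂ | 36 * τ * √(∑ k, C k ^ 2) <
      |∑ k, C k * (‖(p k).1‖ * ‖(p k).2‖ - Real.pi / 4)|} :=
    measurableSet_lt (by fun_prop) (by fun_prop)
  exact (hpair.measureReal_preimage hm.nullMeasurableSet).trans_le h

/-! ### Deterministic estimates -/

theorem sqrt_sum_sq_le {n : ℕ} {w : Fin n → ℝ} {B : ℝ} (h0 : ∀ i, 0 ≤ w i) (hB : ∀ i, w i ≤ B)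
    (hB0 : 0 ≤ B) : √(∑ i, w i ^ 2) ≤ √(n : ℝ) * B := by
  rw [← Real.sqrt_sq hB0, ← Real.sqrt_mul (by positivity)]
  refine Real.sqrt_le_sqrt ((Finset.sum_le_sum fun i _ =>
    pow_le_pow_left₀ (h0 i) (hB i) 2).trans_eq ?_)
  simp

theorem sum_fin_le {n : ℕ} {w : Fin n → ℝ} {B : ℝ} (hB : ∀ i, w i ≤ B) :
    ∑ i, w i ≤ n * B :=
  (Finset.sum_le_card_nsmul _ _ _ fun i _ => hB i).trans_eq (by simp)

theorem le_sum_fin {n : ℕ} {w : Fin n → ℝ} {B : ℝ} (hB : ∀ i, B ≤ w i) :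
    n * B ≤ ∑ i, w i :=
  (by simp : (n : ℝ) * B = _).trans_le (Finset.card_nsmul_le_sum Finset.univ _ _ fun i _ => hB i)

/-- The interference power is close to its mean. The deviation is split according to its source:
the signs of the interfering signals, the cophasing factors `g`, the first-hop powers `h`
and the second-hop powers `f`. -/
theorem interference_deviation {K M : ℕ} {f g : Fin K → ℝ} {h V : Fin K → Fin M → ℝ}
    {T : Fin M → ℝ} {τ B : ℝ} (hτ : 1 ≤ τ) (hB : 0 ≤ B)
    (hf0 : ∀ k, 0 ≤ f k) (hf : ∀ k, f k ≤ 2 * τ)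
    (hg0 : ∀ k, 0 ≤ g k) (hg : ∀ k, g k ≤ 2 * τ * M)
    (hh0 : ∀ k n, 0 ≤ h k n) (hh : ∀ k n, h k n ≤ 2 * τ)
    (hV0 : ∀ k n, 0 ≤ V k n) (hV : ∀ k n, V k n ≤ B)
    (e1 : |∑ n, (T n - ∑ k, V k n * (f k * g k * h k n))| ≤
      144 * τ * √(∑ n, (∑ k, V k n * (f k * g k * h k n)) ^ 2))
    (e2 : |∑ k, f k * (∑ n, V k n * h k n) * (g k - M)| ≤
      144 * τ * √(∑ k, (M * (f k * ∑ n, V k n * h k n)) ^ 2))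
    (e3 : ∀ k, |∑ n, V k n * (h k n - 1)| ≤ 36 * τ * √(∑ n, V k n ^ 2))
    (e4 : |∑ k, (∑ n, V k n) * (f k - 1)| ≤ 36 * τ * √(∑ k, (∑ n, V k n) ^ 2)) :
    |∑ n, T n - M * ∑ k, ∑ n, V k n| ≤
      B * τ ^ 4 * (1224 * (K * M * √(M : ℝ)) + 612 * (√(K : ℝ) * (M : ℝ) ^ 2)) := by
  have hτ0 : (0 : ℝ) ≤ τ := by linarith
  have hτ2 : τ ≤ τ ^ 2 := by nlinarith
  have hτ3 : τ ^ 2 ≤ τ ^ 3 := by nlinarith [sq_nonneg τ]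
  have hτ4 : τ ^ 3 ≤ τ ^ 4 := by nlinarith [pow_nonneg hτ0 3]
  set q : Fin K → ℝ := fun k => ∑ n, V k n * h k n with hq
  have hq0 : ∀ k, 0 ≤ q k := fun k => Finset.sum_nonneg fun n _ => mul_nonneg (hV0 k n) (hh0 k n)
  have hqB : ∀ k, q k ≤ M * (B * (2 * τ)) := fun k =>
    sum_fin_le fun n => mul_le_mul (hV k n) (hh k n) (hh0 k n) hB
  have hsplit : ∑ n, T n - M * ∑ k, ∑ n, V k n =
      ∑ n, (T n - ∑ k, V k n * (f k * g k * h k n)) + ∑ k, f k * q k * (g k - M) +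
      M * ∑ k, f k * (∑ n, V k n * (h k n - 1)) + M * ∑ k, (∑ n, V k n) * (f k - 1) := by
    have h1 : ∑ n, ∑ k, V k n * (f k * g k * h k n) = ∑ k, f k * g k * q k := by
      rw [Finset.sum_comm]
      refine Finset.sum_congr rfl fun k _ => ?_
      rw [hq, Finset.mul_sum]
      exact Finset.sum_congr rfl fun n _ => by ring
    have h2 : ∀ k, ∑ n, V k n * (h k n - 1) = q k - ∑ n, V k n := fun k => by
      simp only [mul_sub, mul_one, Finset.sum_sub_distrib, hq]
    simp_rw [h2]
    rw [Finset.sum_sub_distrib, h1, Finset.mul_sum, Finset.mul_sum, Finset.mul_sum, sub_add,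
      ← Finset.sum_sub_distrib, sub_add, sub_add, ← Finset.sum_sub_distrib,
      ← Finset.sum_sub_distrib]
    congr 1
    exact Finset.sum_congr rfl fun k _ => by ring
  have b1 : |∑ n, (T n - ∑ k, V k n * (f k * g k * h k n))| ≤
      B * τ ^ 4 * (1152 * (K * M * √(M : ℝ))) := by
    refine e1.trans ?_
    have := sqrt_sum_sq_le (w := fun n => ∑ k, V k n * (f k * g k * h k n))
      (B := K * (B * (2 * τ * (2 * τ * M) * (2 * τ))))
      (fun n => Finset.sum_nonneg fun k _ => mul_nonneg (hV0 k n)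
        (mul_nonneg (mul_nonneg (hf0 k) (hg0 k)) (hh0 k n)))
      (fun n => sum_fin_le fun k => mul_le_mul (hV k n)
        (mul_le_mul (mul_le_mul (hf k) (hg k) (hg0 k) (by positivity)) (hh k n) (hh0 k n)
          (by positivity)) (mul_nonneg (mul_nonneg (hf0 k) (hg0 k)) (hh0 k n)) hB) (by positivity)
    calc _ ≤ 144 * τ * _ := mul_le_mul_of_nonneg_left this (by positivity)
      _ = _ := by ring
  have b2 : |∑ k, f k * q k * (g k - M)| ≤ B * τ ^ 4 * (576 * (√(K : ℝ) * (M : ℝ) ^ 2)) := by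
    refine e2.trans ?_
    have := sqrt_sum_sq_le (w := fun k => M * (f k * q k))
      (B := M * (2 * τ * (M * (B * (2 * τ)))))
      (fun k => mul_nonneg (by positivity) (mul_nonneg (hf0 k) (hq0 k)))
      (fun k => mul_le_mul_of_nonneg_left (mul_le_mul (hf k) (hqB k) (hq0 k) (by positivity))
        (by positivity)) (by positivity)
    calc _ ≤ 144 * τ * _ := mul_le_mul_of_nonneg_left this (by positivity)
      _ = B * τ ^ 3 * (576 * (√(K : ℝ) * (M : ℝ) ^ 2)) := by ring
      _ ≤ _ := by gcongr
  have b3 : |M * ∑ k, f k * (∑ n, V k n * (h k n - 1))| ≤ B * τ ^ 4 * (72 * (K * M * √(M : ℝ))) := by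
    rw [abs_mul, Nat.abs_cast]
    have : |∑ k, f k * (∑ n, V k n * (h k n - 1))| ≤ K * (2 * τ * (36 * τ * (√(M : ℝ) * B))) := by
      refine (Finset.abs_sum_le_sum_abs _ _).trans (sum_fin_le fun k => ?_)
      rw [abs_mul, abs_of_nonneg (hf0 k)]
      refine mul_le_mul (hf k) ((e3 k).trans ?_) (abs_nonneg _) (by positivity)
      exact mul_le_mul_of_nonneg_left (sqrt_sum_sq_le (hV0 k) (hV k) hB) (by positivity)
    calc _ ≤ M * (K * (2 * τ * (36 * τ * (√(M : ℝ) * B)))) :=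
          mul_le_mul_of_nonneg_left this (by positivity)
      _ = B * τ ^ 2 * (72 * (K * M * √(M : ℝ))) := by ring
      _ ≤ _ := mul_le_mul_of_nonneg_right (mul_le_mul_of_nonneg_left (hτ3.trans hτ4) hB)
        (by positivity)
  have b4 : |M * ∑ k, (∑ n, V k n) * (f k - 1)| ≤ B * τ ^ 4 * (36 * (√(K : ℝ) * (M : ℝ) ^ 2)) := by
    rw [abs_mul, Nat.abs_cast]
    have := sqrt_sum_sq_le (w := fun k => ∑ n, V k n) (B := M * B)
      (fun k => Finset.sum_nonneg fun n _ => hV0 k n) (fun k => sum_fin_le (hV k)) (by positivity)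
    calc _ ≤ M * (36 * τ * (√(K : ℝ) * (M * B))) :=
          mul_le_mul_of_nonneg_left (e4.trans (mul_le_mul_of_nonneg_left this (by positivity)))
            (by positivity)
      _ = B * τ * (36 * (√(K : ℝ) * (M : ℝ) ^ 2)) := by ring
      _ ≤ _ := mul_le_mul_of_nonneg_right
        (mul_le_mul_of_nonneg_left (hτ2.trans (hτ3.trans hτ4)) hB) (by positivity)
  -- `1224 = 1152 + 72` and `612 = 576 + 36`.
  rw [hsplit]
  refine (abs_add_le _ _).trans ((add_le_add ((abs_add_le _ _).trans
    (add_le_add ((abs_add_le _ _).trans (add_le_add b1 b2)) b3)) b4).trans_eq ?_)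
  ring

/-- The relay noise is close to its mean; the deviation comes from the cophasing factors `g` and from
the second-hop powers `f`. -/
theorem noise_deviation {K M : ℕ} {f g b : Fin K → ℝ} {τ B : ℝ} (hτ : 1 ≤ τ) (hB : 0 ≤ B)
    (hf0 : ∀ k, 0 ≤ f k) (hf : ∀ k, f k ≤ 2 * τ) (hb0 : ∀ k, 0 ≤ b k) (hb : ∀ k, b k ≤ B)
    (e1 : |∑ k, b k * f k * (g k - M)| ≤ 144 * τ * √(∑ k, (M * (b k * f k)) ^ 2))
    (e2 : |∑ k, b k * (f k - 1)| ≤ 36 * τ * √(∑ k, b k ^ 2)) :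
    |∑ k, b k * f k * g k - M * ∑ k, b k| ≤ B * τ ^ 2 * (324 * (√(K : ℝ) * M)) := by
  have hsplit : ∑ k, b k * f k * g k - M * ∑ k, b k
      = ∑ k, b k * f k * (g k - M) + M * ∑ k, b k * (f k - 1) := by
    rw [Finset.mul_sum, Finset.mul_sum, ← Finset.sum_sub_distrib, ← Finset.sum_add_distrib]
    exact Finset.sum_congr rfl fun k _ => by ring
  have h1 := sqrt_sum_sq_le (w := fun k => M * (b k * f k)) (B := M * (B * (2 * τ)))
    (fun k => mul_nonneg (by positivity) (mul_nonneg (hb0 k) (hf0 k)))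
    (fun k => mul_le_mul_of_nonneg_left (mul_le_mul (hb k) (hf k) (hf0 k) hB) (by positivity))
    (by positivity)
  have h2 := sqrt_sum_sq_le hb0 hb hB
  rw [hsplit]
  calc _ ≤ |∑ k, b k * f k * (g k - M)| + |M * ∑ k, b k * (f k - 1)| := abs_add_le _ _
    _ ≤ 144 * τ * (√(K : ℝ) * (M * (B * (2 * τ)))) + M * (36 * τ * (√(K : ℝ) * B)) := by
        rw [abs_mul, Nat.abs_cast]
        gcongr
        · exact e1.trans (by gcongr)
        · exact e2.trans (by gcongr)
    _ = B * τ ^ 2 * (288 * (√(K : ℝ) * M)) + B * τ * (36 * (√(K : ℝ) * M)) := by ring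
    _ ≤ B * τ ^ 2 * (288 * (√(K : ℝ) * M)) + B * τ ^ 2 * (36 * (√(K : ℝ) * M)) := by
        gcongr
        nlinarith
    _ = _ := by ring

/-! ### The typical event -/

/-- The event on which all the fluctuations entering the SINR of destination `m` are under control.
The weights are the gain `C` of the useful signal, the gains `W` of the interfering signals
and the gain `b` of the relay noise. -/
structure Typical (C : Fin K → ℝ) (W : Fin K → Fin M → ℝ) (b : Fin K → ℝ) (m : Fin M) (τ : ℝ)
    (z : Chan K M → ℂ) : Prop where
  channel_le : ∀ i, ‖z i‖ ^ 2 ≤ 2 * τ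
  phaseSum_le : ∀ k, ‖phaseSum z k‖ ^ 2 ≤ 2 * τ * M
  cross_le : ‖∑ p, crossTerm C m z p‖ ^ 2 ≤ 2 * τ * ∑ p, ‖crossTerm C m z p‖ ^ 2
  signal_le : |∑ k, C k * (‖z (.inr (m, k))‖ * ‖z (.inl (k, m))‖ - Real.pi / 4)| ≤
    36 * τ * √(∑ k, C k ^ 2)
  interference_le : |∑ m', (‖∑ k, relayed W m z m' k‖ ^ 2 - ∑ k, ‖relayed W m z m' k‖ ^ 2)| ≤
    144 * τ * √(∑ m', (∑ k, ‖relayed W m z m' k‖ ^ 2) ^ 2)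
  interference_phase_le : |∑ k, ‖z (.inr (m, k))‖ ^ 2 * (∑ n, W k n ^ 2 * ‖z (.inl (k, n))‖ ^ 2) *
      (‖phaseSum z k‖ ^ 2 - M)| ≤
    144 * τ * √(∑ k, (M * (‖z (.inr (m, k))‖ ^ 2 * ∑ n, W k n ^ 2 * ‖z (.inl (k, n))‖ ^ 2)) ^ 2)
  first_hop_le : ∀ k, |∑ n, W k n ^ 2 * (‖z (.inl (k, n))‖ ^ 2 - 1)| ≤
    36 * τ * √(∑ n, (W k n ^ 2) ^ 2)
  second_hop_le : |∑ k, (∑ n, W k n ^ 2) * (‖z (.inr (m, k))‖ ^ 2 - 1)| ≤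
    36 * τ * √(∑ k, (∑ n, W k n ^ 2) ^ 2)
  noise_phase_le : |∑ k, b k ^ 2 * ‖z (.inr (m, k))‖ ^ 2 * (‖phaseSum z k‖ ^ 2 - M)| ≤
    144 * τ * √(∑ k, (M * (b k ^ 2 * ‖z (.inr (m, k))‖ ^ 2)) ^ 2)
  noise_power_le : |∑ k, b k ^ 2 * (‖z (.inr (m, k))‖ ^ 2 - 1)| ≤ 36 * τ * √(∑ k, (b k ^ 2) ^ 2)

theorem measureReal_not_and_le {Ω : Type*} [MeasurableSpace Ω] {P : Measure Ω}
    [IsProbabilityMeasure P] {p q : Ω → Prop} {a b : ℝ} (hp : P.real {ω | ¬p ω} ≤ a)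
    (hq : P.real {ω | ¬q ω} ≤ b) : P.real {ω | ¬(p ω ∧ q ω)} ≤ a + b := by
  refine (measureReal_mono ?_ (measure_ne_top _ _)).trans
    ((measureReal_union_le _ _).trans (add_le_add hp hq))
  intro ω hω
  simp only [Set.mem_ofPred_eq, Set.mem_union] at hω ⊢
  tauto

theorem measureReal_not_forall_le {Ω ι : Type*} [MeasurableSpace Ω] {P : Measure Ω} [Fintype ι]
    [IsProbabilityMeasure P] {p : ι → Ω → Prop} {a : ℝ} (h : ∀ i, P.real {ω | ¬p i ω} ≤ a) :
    P.real {ω | ¬∀ i, p i ω} ≤ Fintype.card ι * a := by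
  have : {ω | ¬∀ i, p i ω} = ⋃ i, {ω | ¬p i ω} := by ext; simp
  rw [this]
  refine (measureReal_iUnion_fintype_le _).trans ?_
  refine (Finset.sum_le_card_nsmul _ _ a fun i _ => h i).trans_eq (by simp)

theorem norm_flipSigns {ι : Type*} (e : ι → Bool) (z : ι → ℂ) (i : ι) : ‖flipSigns e z i‖ = ‖z i‖ :=
  norm_sgn_mul _ _

/-- The coordinates account for `2 * K * M` events of probability at most `2 exp (-τ)`; the other
terms count the events indexed by a relay and the single ones. -/
theorem measureReal_not_typical_le (C : Fin K → ℝ) (W : Fin K → Fin M → ℝ) (b : Fin K → ℝ)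
    (m : Fin M) (hW : ∀ k, W k m = 0) {τ : ℝ} (hτ : 1 ≤ τ) :
    (gaussFamily (Chan K M)).real {z | ¬Typical C W b m τ z} ≤
      (22 + 6 * K + 4 * K * M) * Real.exp (-τ) := by
  have hτ0 : 0 ≤ τ := by linarith
  have e1 := measureReal_not_forall_le (P := gaussFamily (Chan K M))
    (p := fun i z => ‖z i‖ ^ 2 ≤ 2 * τ) (a := 2 * Real.exp (-τ)) fun i => by
      simpa only [not_le] using gaussFamily_coord_tail i τ
  have e2 := measureReal_not_forall_le (P := gaussFamily (Chan K M))
    (p := fun k z => ‖phaseSum z k‖ ^ 2 ≤ 2 * τ * M) (a := 4 * Real.exp (-τ)) fun k => by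
      simpa only [not_le] using phaseSum_tail k hτ0
  have e3 := crossTerm_tail C m hτ0
  have e4 := norm_mul_norm_sum_tail C m hτ
  have e5 := interference_tail W m hW hτ
  have e6 := phaseSum_sq_tail (M := M)
    (fun z k => ‖z (.inr (m, k))‖ ^ 2 * ∑ n, W k n ^ 2 * ‖z (.inl (k, n))‖ ^ 2)
    (fun z k => by positivity) (fun k => by fun_prop) (fun e z => by simp only [norm_flipSigns]) hτ
  have e7 := measureReal_not_forall_le (P := gaussFamily (Chan K M))
    (p := fun (k : Fin K) z => |∑ n, W k n ^ 2 * (‖z (.inl (k, n))‖ ^ 2 - 1)| ≤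
      36 * τ * √(∑ n, (W k n ^ 2) ^ 2)) (a := 2 * Real.exp (-τ)) fun k => by
      simpa only [not_le] using norm_sq_sum_tail (g := fun n : Fin M => (.inl (k, n) : Chan K M))
        (fun a b h => by simpa using h) (fun n => W k n ^ 2) hτ
  have hinj : Function.Injective fun k : Fin K => (.inr (m, k) : Chan K M) :=
    fun a b h => by simpa using h
  have e8 := norm_sq_sum_tail hinj (fun k => ∑ n, W k n ^ 2) hτ
  have e9 := phaseSum_sq_tail (M := M) (fun z k => b k ^ 2 * ‖z (.inr (m, k))‖ ^ 2)
    (fun z k => by positivity) (fun k => by fun_prop) (fun e z => by simp only [norm_flipSigns]) hτ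
  have e10 := norm_sq_sum_tail hinj (fun k => b k ^ 2) hτ
  simp only [← not_le] at e3 e4 e5 e6 e8 e9 e10
  have := measureReal_not_and_le e1 (measureReal_not_and_le e2 (measureReal_not_and_le e3
    (measureReal_not_and_le e4 (measureReal_not_and_le e5 (measureReal_not_and_le e6
    (measureReal_not_and_le e7 (measureReal_not_and_le e8 (measureReal_not_and_le e9 e10))))))))
  refine (measureReal_mono ?_ (measure_ne_top _ _)).trans (this.trans_eq ?_)
  · intro z hz hcon
    obtain ⟨h1, h2, h3, h4, h5, h6, h7, h8, h9, h10⟩ := hcon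
    exact hz ⟨h1, h2, h3, h4, h5, h6, h7, h8, h9, h10⟩
  · simp only [Fintype.card_sum, Fintype.card_prod, Fintype.card_fin]
    push_cast
    ring

/-! ### Deviations of signal, interference and noise -/

theorem relayed_norm_sq (W : Fin K → Fin M → ℝ) (m m' : Fin M) (z : Chan K M → ℂ) (k : Fin K) :
    ‖relayed W m z m' k‖ ^ 2 =
      W k m' ^ 2 * (‖z (.inr (m, k))‖ ^ 2 * ‖phaseSum z k‖ ^ 2 * ‖z (.inl (k, m'))‖ ^ 2) := by
  simp only [relayed, norm_mul, mul_pow, Complex.norm_real, Real.norm_eq_abs, sq_abs]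

/-- At each relay the pair `m` itself is cophased perfectly and contributes its amplitudes; all other
pairs contribute cross terms. -/
theorem sum_relayed_eq (C : Fin K → ℝ) (m : Fin M) (z : Chan K M → ℂ) :
    ∑ k, relayed (fun k _ => C k) m z m k =
      ((∑ k, C k * (‖z (.inr (m, k))‖ * ‖z (.inl (k, m))‖) : ℝ) : ℂ) +
        ∑ p, crossTerm C m z p := by
  rw [Fintype.sum_prod_type]
  push_cast
  rw [← Finset.sum_add_distrib]
  refine Finset.sum_congr rfl fun k _ => ?_
  have h : ∀ n, (C k : ℂ) * (z (.inr (m, k)) * (cophase (z (.inr (n, k))) *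
      cophase (z (.inl (k, n)))) * z (.inl (k, m))) =
      (if n = m then (C k : ℂ) * (‖z (.inr (m, k))‖ * ‖z (.inl (k, m))‖) else 0) +
        crossTerm C m z (k, n) := fun n => by
    unfold crossTerm
    split_ifs with hn
    · rw [hn, ← cophase_mul_self, ← cophase_mul_self]; ring
    · ring
  rw [relayed, phaseSum, Finset.mul_sum, Finset.sum_mul, Finset.mul_sum,
    Finset.sum_congr rfl fun n _ => h n, Finset.sum_add_distrib]
  simp

theorem Typical.signal_deviation {C : Fin K → ℝ} {W : Fin K → Fin M → ℝ} {b : Fin K → ℝ}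
    {m : Fin M} {τ B : ℝ} {z : Chan K M → ℂ} (h : Typical C W b m τ z) (hτ : 1 ≤ τ) (hB : 0 ≤ B)
    (hC0 : ∀ k, 0 ≤ C k) (hC : ∀ k, C k ≤ B) :
    |‖∑ k, relayed (fun k _ => C k) m z m k‖ - Real.pi / 4 * ∑ k, C k| ≤
      39 * τ ^ 2 * B * √((M : ℝ) * K) := by
  have hτ0 : (0 : ℝ) ≤ τ := by linarith
  have hM : (1 : ℝ) ≤ M := by exact_mod_cast (Nat.succ_le_of_lt m.pos)
  set s := ∑ k, C k * (‖z (.inr (m, k))‖ * ‖z (.inl (k, m))‖) with hs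
  have hs0 : 0 ≤ s := Finset.sum_nonneg fun k _ => mul_nonneg (hC0 k) (by positivity)
  have hcross : ‖∑ p, crossTerm C m z p‖ ≤ 3 * τ ^ 2 * B * √((M : ℝ) * K) := by
    have h1 : ∀ p, ‖crossTerm C m z p‖ ^ 2 ≤ B ^ 2 * (2 * τ * (2 * τ)) := fun p => by
      unfold crossTerm
      split_ifs
      · simp; positivity
      · simp only [norm_mul, mul_pow, norm_cophase, Complex.norm_real, Real.norm_eq_abs, sq_abs,
          one_mul, mul_one]
        exact mul_le_mul (pow_le_pow_left₀ (hC0 _) (hC _) 2)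
          (mul_le_mul (h.channel_le _) (h.channel_le _) (by positivity) (by positivity))
          (by positivity) (by positivity)
    have h2 : ∑ p, ‖crossTerm C m z p‖ ^ 2 ≤ (K * M) * (B ^ 2 * (2 * τ * (2 * τ))) :=
      (Finset.sum_le_card_nsmul _ _ _ fun p _ => h1 p).trans_eq (by simp)
    refine le_of_sq_le_sq ?_ (by positivity)
    rw [mul_pow, Real.sq_sqrt (by positivity)]
    refine h.cross_le.trans ((mul_le_mul_of_nonneg_left h2 (by positivity)).trans ?_)
    have h3 : 8 * τ ^ 3 ≤ 9 * τ ^ 4 := by nlinarith [pow_nonneg hτ0 3]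
    calc 2 * τ * ((K * M) * (B ^ 2 * (2 * τ * (2 * τ)))) = 8 * τ ^ 3 * (B ^ 2 * (K * M)) := by ring
      _ ≤ 9 * τ ^ 4 * (B ^ 2 * (K * M)) := by gcongr
      _ = _ := by ring
  have hmain : |s - Real.pi / 4 * ∑ k, C k| ≤ 36 * τ ^ 2 * B * √((M : ℝ) * K) := by
    have h1 : s - Real.pi / 4 * ∑ k, C k =
        ∑ k, C k * (‖z (.inr (m, k))‖ * ‖z (.inl (k, m))‖ - Real.pi / 4) := by
      rw [hs, Finset.mul_sum, ← Finset.sum_sub_distrib]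
      exact Finset.sum_congr rfl fun k _ => by ring
    have h2 := sqrt_sum_sq_le hC0 hC hB
    have h3 : √(K : ℝ) ≤ √((M : ℝ) * K) :=
      Real.sqrt_le_sqrt (le_mul_of_one_le_left (by positivity) hM)
    rw [h1]
    calc _ ≤ 36 * τ * (√(K : ℝ) * B) := h.signal_le.trans (by gcongr)
      _ ≤ 36 * τ ^ 2 * (√((M : ℝ) * K) * B) := by
          gcongr
          nlinarith
      _ = _ := by ring
  have htri : |‖∑ k, relayed (fun k _ => C k) m z m k‖ - s| ≤ ‖∑ p, crossTerm C m z p‖ := by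
    rw [sum_relayed_eq, ← hs]
    have h1 := abs_norm_sub_norm_le ((s : ℂ) + ∑ p, crossTerm C m z p) (s : ℂ)
    rwa [add_sub_cancel_left, Complex.norm_real, Real.norm_eq_abs, abs_of_nonneg hs0] at h1
  calc _ ≤ |‖∑ k, relayed (fun k _ => C k) m z m k‖ - s| + |s - Real.pi / 4 * ∑ k, C k| :=
        abs_sub_le _ _ _
    _ ≤ 3 * τ ^ 2 * B * √((M : ℝ) * K) + 36 * τ ^ 2 * B * √((M : ℝ) * K) :=
        add_le_add (htri.trans hcross) hmain
    _ = _ := by ring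

theorem Typical.interference_deviation {C : Fin K → ℝ} {W : Fin K → Fin M → ℝ} {b : Fin K → ℝ}
    {m : Fin M} {τ B : ℝ} {z : Chan K M → ℂ} (h : Typical C W b m τ z) (hτ : 1 ≤ τ) (hB : 0 ≤ B)
    (hW : ∀ k n, W k n ^ 2 ≤ B) :
    |∑ m', ‖∑ k, relayed W m z m' k‖ ^ 2 - M * ∑ k, ∑ n, W k n ^ 2| ≤
      B * τ ^ 4 * (1224 * (K * M * √(M : ℝ)) + 612 * (√(K : ℝ) * (M : ℝ) ^ 2)) := by
  have h1 := h.interference_le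
  simp only [relayed_norm_sq] at h1
  exact RelayNetwork.interference_deviation hτ hB (fun k => by positivity)
    (fun k => h.channel_le _) (fun k => by positivity) h.phaseSum_le (fun k n => by positivity)
    (fun k n => h.channel_le _) (fun k n => by positivity) hW h1 h.interference_phase_le
    h.first_hop_le h.second_hop_le

theorem Typical.noise_deviation {C : Fin K → ℝ} {W : Fin K → Fin M → ℝ} {b : Fin K → ℝ}
    {m : Fin M} {τ B : ℝ} {z : Chan K M → ℂ} (h : Typical C W b m τ z) (hτ : 1 ≤ τ) (hB : 0 ≤ B)
    (hb : ∀ k, b k ^ 2 ≤ B) :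
    |∑ k, b k ^ 2 * ‖z (.inr (m, k))‖ ^ 2 * ‖phaseSum z k‖ ^ 2 - M * ∑ k, b k ^ 2| ≤
      B * τ ^ 2 * (324 * (√(K : ℝ) * M)) :=
  RelayNetwork.noise_deviation hτ hB (fun k => by positivity) (fun k => h.channel_le _)
    (fun k => by positivity) hb h.noise_phase_le h.noise_power_le

/-! ### The relay gains -/

/-- The hypotheses on the average energies of the links. -/
structure Constants.Bounds (c : Constants) (E : Fin K → Fin M → ℝ) (P : Fin M → Fin K → ℝ) :
    Prop where
  Elo_pos : 0 < c.Elo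
  Plo_pos : 0 < c.Plo
  Prel_pos : 0 < c.Prel
  sigma_pos : 0 < c.sigma
  E_mem : ∀ k m, c.Elo ≤ E k m ∧ E k m ≤ c.Ehi
  P_mem : ∀ m k, c.Plo ≤ P m k ∧ P m k ≤ c.Phi

/-- All relay gains, squared, are a power `y` times one factor depending only on the relay. -/
theorem gain_eq (c : Constants) (hPrel : 0 ≤ c.Prel) (E : Fin K → Fin M → ℝ) (k : Fin K) (y : ℝ)
    (hE : ∀ k m, 0 ≤ E k m) :
    √((K : ℝ) * (M : ℝ)) * dP2 c E k * √y = √(c.Prel *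
      ((K * M) / ((K : ℝ) * ∑ m : Fin M, E k m + (M : ℝ) * (K : ℝ) * c.sigma ^ 2)) * y) := by
  have h1 : (0 : ℝ) ≤ (K : ℝ) * ∑ m : Fin M, E k m + (M : ℝ) * (K : ℝ) * c.sigma ^ 2 := by
    have := Finset.sum_nonneg fun m (_ : m ∈ Finset.univ) => hE k m
    positivity
  rw [dP2]
  set A := (K : ℝ) * ∑ m : Fin M, E k m + (M : ℝ) * (K : ℝ) * c.sigma ^ 2
  rw [Real.sqrt_mul (show 0 ≤ c.Prel * (K * M / A) by positivity), Real.sqrt_mul hPrel,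
    Real.sqrt_div (by positivity)]
  ring

theorem gain_mem {c : Constants} {E : Fin K → Fin M → ℝ} {P : Fin M → Fin K → ℝ}
    (h : c.Bounds E P) (hM : 0 < M) (k : Fin K) :
    1 / (c.Ehi + c.sigma ^ 2) ≤
        (K * M) / ((K : ℝ) * ∑ m : Fin M, E k m + (M : ℝ) * (K : ℝ) * c.sigma ^ 2) ∧
      (K * M) / ((K : ℝ) * ∑ m : Fin M, E k m + (M : ℝ) * (K : ℝ) * c.sigma ^ 2) ≤
        1 / (c.Elo + c.sigma ^ 2) := by
  have hK' : (0 : ℝ) < K := by exact_mod_cast k.pos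
  have hM' : (0 : ℝ) < M := by exact_mod_cast hM
  have h1 : (M : ℝ) * c.Elo ≤ ∑ m, E k m := le_sum_fin fun m => (h.E_mem k m).1
  have h2 : ∑ m, E k m ≤ (M : ℝ) * c.Ehi := sum_fin_le fun m => (h.E_mem k m).2
  have hE0 := h.Elo_pos
  have hE1 : 0 < c.Ehi := hE0.trans_le ((h.E_mem k ⟨0, hM⟩).1.trans (h.E_mem k ⟨0, hM⟩).2)
  have hA : 0 < ∑ m, E k m := lt_of_lt_of_le (by positivity) h1
  have e1 := mul_le_mul_of_nonneg_left h1 hK'.le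
  have e2 := mul_le_mul_of_nonneg_left h2 hK'.le
  constructor
  · rw [div_le_div_iff₀ (by positivity) (by positivity)]
    linarith
  · rw [div_le_div_iff₀ (by positivity) (by positivity)]
    linarith

theorem gain_bounds {c : Constants} {E : Fin K → Fin M → ℝ} {P : Fin M → Fin K → ℝ}
    (h : c.Bounds E P) (hM : 0 < M) (k : Fin K) {y ylo yhi : ℝ} (hlo : 0 ≤ ylo) (h1 : ylo ≤ y)
    (h2 : y ≤ yhi) :
    √(ylo * c.Prel / (c.Ehi + c.sigma ^ 2)) ≤ √((K : ℝ) * (M : ℝ)) * dP2 c E k * √y ∧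
      √((K : ℝ) * (M : ℝ)) * dP2 c E k * √y ≤ √(yhi * c.Prel / (c.Elo + c.sigma ^ 2)) := by
  obtain ⟨g1, g2⟩ := gain_mem h hM k
  have hE0 := h.Elo_pos
  have hP := h.Prel_pos
  have hE1 : 0 < c.Ehi := hE0.trans_le ((h.E_mem k ⟨0, hM⟩).1.trans (h.E_mem k ⟨0, hM⟩).2)
  rw [gain_eq c h.Prel_pos.le E k y fun k m => hE0.le.trans (h.E_mem k m).1]
  have hg0 : 0 ≤ (K * M) / ((K : ℝ) * ∑ m : Fin M, E k m + (M : ℝ) * (K : ℝ) * c.sigma ^ 2) :=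
    le_trans (by positivity) g1
  constructor
  · refine Real.sqrt_le_sqrt ?_
    calc ylo * c.Prel / (c.Ehi + c.sigma ^ 2) = c.Prel * (1 / (c.Ehi + c.sigma ^ 2)) * ylo := by
          ring
      _ ≤ _ := mul_le_mul (mul_le_mul_of_nonneg_left g1 hP.le) h1 hlo (by positivity)
  · refine Real.sqrt_le_sqrt ?_
    calc _ ≤ c.Prel * (1 / (c.Elo + c.sigma ^ 2)) * yhi :=
          mul_le_mul (mul_le_mul_of_nonneg_left g2 hP.le) h2 (hlo.trans h1) (by positivity)
      _ = _ := by ring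

theorem coeffBig_mem {c : Constants} {E : Fin K → Fin M → ℝ} {P : Fin M → Fin K → ℝ}
    (h : c.Bounds E P) (hM : 0 < M) (m m' : Fin M) (k : Fin K) :
    c.Clo ≤ coeffBig c E P m m' k ∧ coeffBig c E P m m' k ≤ c.Chi := by
  have hE0 := h.Elo_pos
  have hP0 := h.Plo_pos
  exact gain_bounds h hM k (by positivity)
    (mul_le_mul (h.P_mem m k).1 (h.E_mem k m').1 hE0.le (hP0.le.trans (h.P_mem m k).1))
    (mul_le_mul (h.P_mem m k).2 (h.E_mem k m').2 (hE0.le.trans (h.E_mem k m').1)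
      (hP0.le.trans ((h.P_mem m k).1.trans (h.P_mem m k).2)))

theorem coeffSmall_mem {c : Constants} {E : Fin K → Fin M → ℝ} {P : Fin M → Fin K → ℝ}
    (h : c.Bounds E P) (hM : 0 < M) (m : Fin M) (k : Fin K) :
    c.clo ≤ coeffSmall c E P m k ∧ coeffSmall c E P m k ≤ c.chi :=
  gain_bounds h hM k h.Plo_pos.le (h.P_mem m k).1 (h.P_mem m k).2

/-- The gains of the interfering signals: those of all sources, except source `m` itself. -/
def interferenceGain (c : Constants) (E : Fin K → Fin M → ℝ) (P : Fin M → Fin K → ℝ) (m : Fin M)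
    (k : Fin K) (m' : Fin M) : ℝ :=
  if m' = m then 0 else coeffBig c E P m m' k

theorem interferenceGain_sq_le {c : Constants} {E : Fin K → Fin M → ℝ} {P : Fin M → Fin K → ℝ}
    (h : c.Bounds E P) (hM : 0 < M) (m m' : Fin M) (k : Fin K) :
    interferenceGain c E P m k m' ^ 2 ≤ c.Chi ^ 2 := by
  unfold interferenceGain
  split_ifs
  · simp; positivity
  · obtain ⟨h1, h2⟩ := coeffBig_mem h hM m m' k
    exact pow_le_pow_left₀ ((Real.sqrt_nonneg _).trans h1) h2 2

theorem le_sum_interferenceGain_sq {c : Constants} {E : Fin K → Fin M → ℝ} {P : Fin M → Fin K → ℝ}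
    (h : c.Bounds E P) (hM : 0 < M) (m : Fin M) (k : Fin K) :
    ((M : ℝ) - 1) * c.Clo ^ 2 ≤ ∑ m', interferenceGain c E P m k m' ^ 2 := by
  have h1 : ∑ m', interferenceGain c E P m k m' ^ 2 =
      ∑ m' ∈ Finset.univ.erase m, coeffBig c E P m m' k ^ 2 := by
    rw [← Finset.add_sum_erase _ _ (Finset.mem_univ m)]
    simp only [interferenceGain, if_true]
    rw [zero_pow two_ne_zero, zero_add]
    exact Finset.sum_congr rfl fun m' hm' => by rw [if_neg (Finset.ne_of_mem_erase hm')]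
  rw [h1]
  refine le_trans (le_of_eq ?_) (Finset.card_nsmul_le_sum _ _ (c.Clo ^ 2) fun m' _ =>
    pow_le_pow_left₀ (Real.sqrt_nonneg _) (coeffBig_mem h hM m m' k).1 2)
  rw [Finset.card_erase_of_mem (Finset.mem_univ m), Finset.card_univ, Fintype.card_fin,
    nsmul_eq_mul, Nat.cast_sub hM, Nat.cast_one]

theorem sum_aTerm (c : Constants) (E : Fin K → Fin M → ℝ) (P : Fin M → Fin K → ℝ)
    (z : Chan K M → ℂ) (m m' : Fin M) (k : Fin K) :
    ∑ n, aTerm c E P (fun k n => z (.inl (k, n))) (fun n k => z (.inr (n, k))) m m' n k =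
      (coeffBig c E P m m' k : ℂ) * (z (.inr (m, k)) * phaseSum z k * z (.inl (k, m'))) := by
  rw [phaseSum, Finset.mul_sum, Finset.sum_mul, Finset.mul_sum]
  refine Finset.sum_congr rfl fun n _ => ?_
  simp only [aTerm, cophase]
  ring

theorem sum_bTerm (c : Constants) (E : Fin K → Fin M → ℝ) (P : Fin M → Fin K → ℝ)
    (z : Chan K M → ℂ) (m : Fin M) (k : Fin K) :
    ∑ n, bTerm c E P (fun k n => z (.inl (k, n))) (fun n k => z (.inr (n, k))) m n k =
      (coeffSmall c E P m k : ℂ) * (z (.inr (m, k)) * phaseSum z k) := by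
  rw [phaseSum, Finset.mul_sum, Finset.mul_sum]
  refine Finset.sum_congr rfl fun n _ => ?_
  simp only [bTerm, cophase]
  ring

theorem sinrP2_eq (c : Constants) (E : Fin K → Fin M → ℝ) (P : Fin M → Fin K → ℝ)
    (z : Chan K M → ℂ) (m : Fin M) :
    sinrP2 c E P (fun k n => z (.inl (k, n))) (fun n k => z (.inr (n, k))) m =
      ‖∑ k, relayed (fun k _ => coeffBig c E P m m k) m z m k‖ ^ 2 /
        (∑ m', ‖∑ k, relayed (interferenceGain c E P m) m z m' k‖ ^ 2 + c.sigma ^ 2 * M *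
          ∑ k, coeffSmall c E P m k ^ 2 * ‖z (.inr (m, k))‖ ^ 2 * ‖phaseSum z k‖ ^ 2 +
          K * (M : ℝ) ^ 2 * c.sigma ^ 2) := by
  simp only [sinrP2, sum_aTerm, sum_bTerm]
  congr 3
  · rw [← Finset.add_sum_erase _ _ (Finset.mem_univ m)]
    simp only [relayed, interferenceGain, if_true]
    rw [Complex.ofReal_zero]
    simp only [zero_mul, Finset.sum_const_zero, norm_zero]
    rw [zero_pow two_ne_zero, zero_add]
    exact Finset.sum_congr rfl fun m' hm' => by simp only [if_neg (Finset.ne_of_mem_erase hm')]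
  · congr 1
    refine Finset.sum_congr rfl fun k _ => ?_
    simp only [norm_mul, mul_pow, Complex.norm_real, Real.norm_eq_abs, sq_abs]
    ring

/-! ### The concentration interval -/

/-- The constant `CSNhi` cancels, and the scale `K / M ^ 2` is `K ^ 2 / (K * M ^ 2)`, so that the
numerator is the squared margin of the useful signal. -/
theorem LP2_eq (c : Constants) {K M : ℕ} (hK : 0 < K) (hM : 0 < M) (hClo : 0 < c.Clo)
    (hsigma : 0 < c.sigma) (x : ℝ) :
    LP2 c K M x =
      (max 0 (Real.pi / 4 * (K * c.Clo) - 2 * x * √((M : ℝ) * K))) ^ 2 /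
        (K * (M : ℝ) ^ 2 * (c.Chi ^ 2 + 4 * (x / min √(M : ℝ) √(K : ℝ)) +
          c.sigma ^ 2 * (c.chi ^ 2 + 2 * (x / √(K : ℝ))) + c.sigma ^ 2)) := by
  have hK' : (0 : ℝ) < K := by exact_mod_cast hK
  have hM' : (0 : ℝ) < M := by exact_mod_cast hM
  have hpi := Real.pi_pos
  have hS : 0 < c.CSNhi := by
    rw [Constants.CSNhi]
    exact Real.sqrt_pos.2 (by positivity)
  have hq : (K : ℝ) * √((M : ℝ) / K) = √((M : ℝ) * K) := by
    rw [Real.sqrt_div hM'.le, Real.sqrt_mul hM'.le]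
    nth_rewrite 1 [← Real.mul_self_sqrt hK'.le]
    field_simp
  have hnum : max 0 (Real.pi / 4 * (K * c.Clo) - 2 * x * √((M : ℝ) * K)) = Real.pi / 4 *
      (K * c.Clo) * max 0 (1 - 8 / (c.Clo * Real.pi) * √((M : ℝ) / (K : ℝ)) * x) := by
    rw [mul_max_of_nonneg _ _ (by positivity), mul_zero, ← hq]
    congr 1
    field_simp
    ring
  rw [hnum, LP2]
  have hden : c.Chi ^ 2 / c.CSNhi ^ 2 + 4 / c.CSNhi ^ 2 * (x / min √(M : ℝ) √(K : ℝ))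
        + c.sigma ^ 2 / c.CSNhi ^ 2 * (c.chi ^ 2 + 2 * (x / √(K : ℝ)))
        + c.sigma ^ 2 / c.CSNhi ^ 2 = (c.Chi ^ 2 + 4 * (x / min √(M : ℝ) √(K : ℝ)) +
          c.sigma ^ 2 * (c.chi ^ 2 + 2 * (x / √(K : ℝ))) + c.sigma ^ 2) / c.CSNhi ^ 2 := by
    ring
  rw [hden]
  set R := c.Chi ^ 2 + 4 * (x / min √(M : ℝ) √(K : ℝ)) +
          c.sigma ^ 2 * (c.chi ^ 2 + 2 * (x / √(K : ℝ))) + c.sigma ^ 2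
  set a := max 0 (1 - 8 / (c.Clo * Real.pi) * √((M : ℝ) / (K : ℝ)) * x)
  rw [div_div_eq_mul_div]
  by_cases hR : R = 0
  · simp [hR]
  · field_simp
    ring

theorem UP2_eq (c : Constants) {K M : ℕ} (hK : 0 < K) (hM : 0 < M) (hChi : 0 < c.Chi)
    (hsigma : 0 < c.sigma) (x : ℝ) :
    UP2 c K M x =
      (Real.pi / 4 * (K * c.Chi) + 2 * x * √((M : ℝ) * K)) ^ 2 /
        (K * (M : ℝ) ^ 2 * (max 0 (c.Clo ^ 2 * (((M : ℝ) - 1) / M) -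
          4 * (x / min √(M : ℝ) √(K : ℝ))) +
          max 0 (c.sigma ^ 2 * (c.clo ^ 2 - 2 * (x / √(K : ℝ)))) + c.sigma ^ 2)) := by
  have hK' : (0 : ℝ) < K := by exact_mod_cast hK
  have hM' : (0 : ℝ) < M := by exact_mod_cast hM
  have hpi := Real.pi_pos
  have hS : 0 < c.CSNlo := by
    rw [Constants.CSNlo]
    exact Real.sqrt_pos.2 (by positivity)
  have hq : (K : ℝ) * √((M : ℝ) / K) = √((M : ℝ) * K) := by
    rw [Real.sqrt_div hM'.le, Real.sqrt_mul hM'.le]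
    nth_rewrite 1 [← Real.mul_self_sqrt hK'.le]
    field_simp
  have hnum : Real.pi / 4 * (K * c.Chi) + 2 * x * √((M : ℝ) * K) = Real.pi / 4 *
      (K * c.Chi) * (1 + 8 / (c.Chi * Real.pi) * √((M : ℝ) / (K : ℝ)) * x) := by
    rw [← hq]
    field_simp
    ring
  have hmax : ∀ y, max 0 (y / c.CSNlo ^ 2) = max 0 y / c.CSNlo ^ 2 := fun y => by
    rw [max_div_div_right (by positivity) 0 y |>.symm, zero_div]
  rw [hnum, UP2]
  have e1 : c.Clo ^ 2 / c.CSNlo ^ 2 * (((M : ℝ) - 1) / (M : ℝ))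
      - 4 / c.CSNlo ^ 2 * (x / min √(M : ℝ) √(K : ℝ)) =
      (c.Clo ^ 2 * (((M : ℝ) - 1) / M) - 4 * (x / min √(M : ℝ) √(K : ℝ))) / c.CSNlo ^ 2 := by ring
  have e2 : c.sigma ^ 2 / c.CSNlo ^ 2 * (c.clo ^ 2 - 2 * (x / √(K : ℝ))) =
      (c.sigma ^ 2 * (c.clo ^ 2 - 2 * (x / √(K : ℝ)))) / c.CSNlo ^ 2 := by ring
  rw [e1, e2, hmax, hmax, ← add_div, ← add_div]
  set R := max 0 (c.Clo ^ 2 * (((M : ℝ) - 1) / M) - 4 * (x / min √(M : ℝ) √(K : ℝ))) +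
          max 0 (c.sigma ^ 2 * (c.clo ^ 2 - 2 * (x / √(K : ℝ)))) + c.sigma ^ 2
  have hR : 0 < R := by
    have := le_max_left 0 (c.Clo ^ 2 * (((M : ℝ) - 1) / M) - 4 * (x / min √(M : ℝ) √(K : ℝ)))
    have := le_max_left 0 (c.sigma ^ 2 * (c.clo ^ 2 - 2 * (x / √(K : ℝ))))
    positivity
  rw [div_div_eq_mul_div]
  field_simp
  ring

/-- The SINR lies in the concentration interval as soon as the useful signal `s`, the
interference power `D` and the noise power `N` are within the announced margins. -/
theorem sinr_mem_Icc (c : Constants) {K M : ℕ} (hK : 0 < K) (hM : 0 < M) (hClo : 0 < c.Clo)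
    (hChi : 0 < c.Chi) (hsigma : 0 < c.sigma) {x s D N : ℝ} (hs : 0 ≤ s) (hD : 0 ≤ D)
    (hN : 0 ≤ N)
    (hs1 : Real.pi / 4 * (K * c.Clo) - 2 * x * √((M : ℝ) * K) ≤ s)
    (hs2 : s ≤ Real.pi / 4 * (K * c.Chi) + 2 * x * √((M : ℝ) * K))
    (hD1 : K * (M : ℝ) ^ 2 * (c.Clo ^ 2 * (((M : ℝ) - 1) / M) -
      4 * (x / min √(M : ℝ) √(K : ℝ))) ≤ D)
    (hD2 : D ≤ K * (M : ℝ) ^ 2 * (c.Chi ^ 2 + 4 * (x / min √(M : ℝ) √(K : ℝ))))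
    (hN1 : K * M * (c.clo ^ 2 - 2 * (x / √(K : ℝ))) ≤ N)
    (hN2 : N ≤ K * M * (c.chi ^ 2 + 2 * (x / √(K : ℝ)))) :
    s ^ 2 / (D + c.sigma ^ 2 * M * N + K * (M : ℝ) ^ 2 * c.sigma ^ 2) ∈
      Set.Icc (LP2 c K M x) (UP2 c K M x) := by
  have hK' : (0 : ℝ) < K := by exact_mod_cast hK
  have hM' : (0 : ℝ) < M := by exact_mod_cast hM
  have hden : 0 < D + c.sigma ^ 2 * M * N + K * (M : ℝ) ^ 2 * c.sigma ^ 2 := by positivity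
  have hc : 0 ≤ c.sigma ^ 2 * M := by positivity
  rw [LP2_eq c hK hM hClo hsigma, UP2_eq c hK hM hChi hsigma]
  constructor
  · refine div_le_div₀ (sq_nonneg s) (pow_le_pow_left₀ (le_max_left _ _) (max_le hs hs1) 2) hden ?_
    have := mul_le_mul_of_nonneg_left hN2 hc
    linarith
  · have hmax1 : K * (M : ℝ) ^ 2 * max 0 (c.Clo ^ 2 * (((M : ℝ) - 1) / M) -
        4 * (x / min √(M : ℝ) √(K : ℝ))) ≤ D := by
      rw [mul_max_of_nonneg _ _ (by positivity), mul_zero]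
      exact max_le hD hD1
    have hmax2 : K * (M : ℝ) ^ 2 * max 0 (c.sigma ^ 2 * (c.clo ^ 2 - 2 * (x / √(K : ℝ)))) ≤
        c.sigma ^ 2 * M * N := by
      rw [mul_max_of_nonneg _ _ (by positivity), mul_zero]
      refine max_le (by positivity) ?_
      have := mul_le_mul_of_nonneg_left hN1 hc
      linarith
    refine div_le_div₀ (sq_nonneg _) (pow_le_pow_left₀ hs hs2 2) ?_ ?_
    · have := le_max_left 0 (c.Clo ^ 2 * (((M : ℝ) - 1) / M) - 4 * (x / min √(M : ℝ) √(K : ℝ)))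
      have := le_max_left 0 (c.sigma ^ 2 * (c.clo ^ 2 - 2 * (x / √(K : ℝ))))
      positivity
    · linarith

/-- The exponent `2 / 9` leaves room: `x = (τ / Δ) ^ (9 / 2)` dominates `τ ^ 4` with large
constants. -/
theorem x_lower_bounds (c : Constants) (hChi : 0 < c.Chi) (hchi : 0 < c.chi) {x : ℝ} (hx : 1 ≤ x)
    (hτ : 1 ≤ DeltaP2 c * x ^ (2 / 9 : ℝ)) :
    512 * (DeltaP2 c * x ^ (2 / 9 : ℝ)) ^ 4 ≤ x ∧
      512 * c.Chi ^ 2 * (DeltaP2 c * x ^ (2 / 9 : ℝ)) ^ 4 ≤ x ∧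
      512 * c.chi ^ 2 * (DeltaP2 c * x ^ (2 / 9 : ℝ)) ^ 4 ≤ x := by
  set Δ := DeltaP2 c with hΔ
  set y := x ^ (2 / 9 : ℝ) with hy
  have hx0 : 0 ≤ x := by linarith
  have hy0 : 0 ≤ y := Real.rpow_nonneg hx0 _
  have hxy : x = y ^ 4 * √y := by
    rw [Real.sqrt_eq_rpow, hy, ← Real.rpow_natCast, ← Real.rpow_mul hx0, ← Real.rpow_mul hx0,
      ← Real.rpow_add (by linarith)]
    norm_num
  have h1 : Δ ≤ 1 / 4 := by
    refine ((min_le_left _ _).trans (min_le_left _ _)).trans ?_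
    calc (2 : ℝ) ^ (-(11 / 5) : ℝ) ≤ (2 : ℝ) ^ (-2 : ℝ) :=
          Real.rpow_le_rpow_of_exponent_le (by norm_num) (by norm_num)
      _ = 1 / 4 := by
          rw [Real.rpow_neg (by norm_num)]; norm_num
  have h2 : Δ ≤ 1 / (8 * c.Chi ^ 4) := (min_le_right _ _).trans (min_le_left _ _)
  have h3 : Δ ≤ 1 / (4 * c.chi ^ 4) := (min_le_right _ _).trans (min_le_right _ _)
  have hτ0 : 0 ≤ Δ * y := by linarith
  have hy4 : 4 * (Δ * y) ≤ y := by nlinarith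
  have hs1 : 2 ≤ √y := Real.le_sqrt_of_sq_le (by linarith)
  have hs2 : 2 * c.Chi ^ 2 ≤ √y := by
    refine Real.le_sqrt_of_sq_le ?_
    have : 1 ≤ 1 / (8 * c.Chi ^ 4) * y := hτ.trans (mul_le_mul_of_nonneg_right h2 hy0)
    rw [div_mul_eq_mul_div, one_mul, le_div_iff₀ (by positivity)] at this
    nlinarith [pow_pos hChi 4]
  have hs3 : 2 * c.chi ^ 2 ≤ √y := by
    refine Real.le_sqrt_of_sq_le ?_
    have : 1 ≤ 1 / (4 * c.chi ^ 4) * y := hτ.trans (mul_le_mul_of_nonneg_right h3 hy0)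
    rw [div_mul_eq_mul_div, one_mul, le_div_iff₀ (by positivity)] at this
    nlinarith [pow_pos hchi 4]
  have hp : 256 * (Δ * y) ^ 4 ≤ y ^ 4 := by
    calc 256 * (Δ * y) ^ 4 = (4 * (Δ * y)) ^ 4 := by ring
      _ ≤ y ^ 4 := pow_le_pow_left₀ (by positivity) hy4 4
  have key : ∀ u, 0 ≤ u → 2 * u ≤ √y → 512 * u * (Δ * y) ^ 4 ≤ x := fun u hu h => by
    calc 512 * u * (Δ * y) ^ 4 = (256 * (Δ * y) ^ 4) * (2 * u) := by ring
      _ ≤ y ^ 4 * √y := mul_le_mul hp h (by positivity) (by positivity)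
      _ = x := hxy.symm
  exact ⟨by simpa using key 1 (by norm_num) (by simpa using hs1), key _ (sq_nonneg _) hs2,
    key _ (sq_nonneg _) hs3⟩

theorem Typical.sinrP2_mem {K M : ℕ} {c : Constants} {E : Fin K → Fin M → ℝ}
    {P : Fin M → Fin K → ℝ} (hc : c.Bounds E P) {m : Fin M} {τ x : ℝ} {z : Chan K M → ℂ}
    (hK : 0 < K) (hτ : 1 ≤ τ) (hx : 512 * τ ^ 4 ≤ x) (hx1 : 512 * c.Chi ^ 2 * τ ^ 4 ≤ x)
    (hx2 : 512 * c.chi ^ 2 * τ ^ 4 ≤ x) (hClo : 0 < c.Clo) (hChi : 0 < c.Chi)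
    (h : Typical (fun k => coeffBig c E P m m k) (interferenceGain c E P m)
      (fun k => coeffSmall c E P m k) m τ z) :
    sinrP2 c E P (fun k n => z (.inl (k, n))) (fun n k => z (.inr (n, k))) m ∈
      Set.Icc (LP2 c K M x) (UP2 c K M x) := by
  have hM : 0 < M := m.pos
  have hK' : (0 : ℝ) < K := by exact_mod_cast hK
  have hM' : (0 : ℝ) < M := by exact_mod_cast hM
  have hτ0 : (0 : ℝ) < τ := by linarith
  have hτ24 : τ ^ 2 ≤ τ ^ 4 := pow_le_pow_right₀ hτ (by norm_num)
  have hx0 : 0 < x := lt_of_lt_of_le (by positivity) hx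
  have hbig := fun k => coeffBig_mem hc hM m m k
  have hsmall := fun k => coeffSmall_mem hc hM m k
  have hclo : 0 ≤ c.clo := Real.sqrt_nonneg _
  rw [sinrP2_eq]
  -- The useful signal.
  have dS := h.signal_deviation hτ hChi.le (fun k => hClo.le.trans (hbig k).1) fun k => (hbig k).2
  have mS1 : K * c.Clo ≤ ∑ k, coeffBig c E P m m k := le_sum_fin fun k => (hbig k).1
  have mS2 : ∑ k, coeffBig c E P m m k ≤ K * c.Chi := sum_fin_le fun k => (hbig k).2
  have bS : 39 * τ ^ 2 * c.Chi * √((M : ℝ) * K) ≤ 2 * x * √((M : ℝ) * K) := by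
    refine mul_le_mul_of_nonneg_right ?_ (Real.sqrt_nonneg _)
    have h1 : c.Chi ≤ 1 + c.Chi ^ 2 := by nlinarith [sq_nonneg (c.Chi - 1)]
    calc 39 * τ ^ 2 * c.Chi ≤ 39 * τ ^ 4 * (1 + c.Chi ^ 2) := by gcongr
      _ ≤ 512 * τ ^ 4 * (1 + c.Chi ^ 2) := by gcongr; norm_num
      _ ≤ 2 * x := by linarith
  have hpi := Real.pi_pos
  have mS1' := mul_le_mul_of_nonneg_left mS1 (by positivity : 0 ≤ Real.pi / 4)
  have mS2' := mul_le_mul_of_nonneg_left mS2 (by positivity : 0 ≤ Real.pi / 4)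
  have dS' := abs_le.1 dS
  -- The interference.
  have dD := h.interference_deviation hτ (sq_nonneg c.Chi)
    fun k n => interferenceGain_sq_le hc hM m n k
  have mD1 : K * (((M : ℝ) - 1) * c.Clo ^ 2) ≤ ∑ k, ∑ n, interferenceGain c E P m k n ^ 2 :=
    le_sum_fin fun k => le_sum_interferenceGain_sq hc hM m k
  have mD2 : ∑ k, ∑ n, interferenceGain c E P m k n ^ 2 ≤ K * (M * c.Chi ^ 2) :=
    sum_fin_le fun k => sum_fin_le fun n => interferenceGain_sq_le hc hM m n k
  have bD : c.Chi ^ 2 * τ ^ 4 * (1224 * (K * M * √(M : ℝ)) + 612 * (√(K : ℝ) * (M : ℝ) ^ 2)) ≤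
      K * (M : ℝ) ^ 2 * (4 * (x / min √(M : ℝ) √(K : ℝ))) := by
    have hsM : 0 < √(M : ℝ) := Real.sqrt_pos.2 hM'
    have hsK : 0 < √(K : ℝ) := Real.sqrt_pos.2 hK'
    set r := min √(M : ℝ) √(K : ℝ)
    have hr : 0 < r := lt_min hsM hsK
    have h1 : K * M * √(M : ℝ) ≤ K * (M : ℝ) ^ 2 / r := by
      rw [le_div_iff₀ hr]
      calc K * M * √(M : ℝ) * r ≤ K * M * √(M : ℝ) * √(M : ℝ) := by
            gcongr; exact min_le_left _ _
        _ = K * (M : ℝ) ^ 2 := by rw [mul_assoc _ √(M : ℝ), Real.mul_self_sqrt hM'.le]; ring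
    have h2 : √(K : ℝ) * (M : ℝ) ^ 2 ≤ K * (M : ℝ) ^ 2 / r := by
      rw [le_div_iff₀ hr]
      calc √(K : ℝ) * (M : ℝ) ^ 2 * r ≤ √(K : ℝ) * (M : ℝ) ^ 2 * √(K : ℝ) := by
            gcongr; exact min_le_right _ _
        _ = K * (M : ℝ) ^ 2 := by rw [mul_right_comm, Real.mul_self_sqrt hK'.le]
    calc c.Chi ^ 2 * τ ^ 4 * (1224 * (K * M * √(M : ℝ)) + 612 * (√(K : ℝ) * (M : ℝ) ^ 2))
        ≤ c.Chi ^ 2 * τ ^ 4 * (1224 * (K * (M : ℝ) ^ 2 / r) + 612 * (K * (M : ℝ) ^ 2 / r)) := by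
          gcongr
      _ = (1836 * c.Chi ^ 2 * τ ^ 4) * (K * (M : ℝ) ^ 2 / r) := by ring
      _ ≤ (4 * x) * (K * (M : ℝ) ^ 2 / r) := by
          refine mul_le_mul_of_nonneg_right ?_ (by positivity)
          have : 0 ≤ c.Chi ^ 2 * τ ^ 4 := by positivity
          linarith
      _ = _ := by ring
  have dD' := abs_le.1 dD
  have mD1' := mul_le_mul_of_nonneg_left mD1 hM'.le
  have mD2' := mul_le_mul_of_nonneg_left mD2 hM'.le
  -- The noise of the relays.
  have dN := h.noise_deviation hτ (sq_nonneg c.chi)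
    fun k => pow_le_pow_left₀ (hclo.trans (hsmall k).1) (hsmall k).2 2
  have mN1 : K * c.clo ^ 2 ≤ ∑ k, coeffSmall c E P m k ^ 2 :=
    le_sum_fin fun k => pow_le_pow_left₀ hclo (hsmall k).1 2
  have mN2 : ∑ k, coeffSmall c E P m k ^ 2 ≤ K * c.chi ^ 2 :=
    sum_fin_le fun k => pow_le_pow_left₀ (hclo.trans (hsmall k).1) (hsmall k).2 2
  have bN : c.chi ^ 2 * τ ^ 2 * (324 * (√(K : ℝ) * M)) ≤ K * M * (2 * (x / √(K : ℝ))) := by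
    have h1 : K * M * (2 * (x / √(K : ℝ))) = 2 * x * (√(K : ℝ) * M) := by
      have hsK : 0 < √(K : ℝ) := Real.sqrt_pos.2 hK'
      nth_rewrite 1 [← Real.mul_self_sqrt hK'.le]
      field_simp
    rw [h1]
    calc c.chi ^ 2 * τ ^ 2 * (324 * (√(K : ℝ) * M))
        ≤ c.chi ^ 2 * τ ^ 4 * (324 * (√(K : ℝ) * M)) := by gcongr
      _ = (324 * c.chi ^ 2 * τ ^ 4) * (√(K : ℝ) * M) := by ring
      _ ≤ 2 * x * (√(K : ℝ) * M) := by
          refine mul_le_mul_of_nonneg_right ?_ (by positivity)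
          have : 0 ≤ c.chi ^ 2 * τ ^ 4 := by positivity
          linarith
  have dN' := abs_le.1 dN
  have mN1' := mul_le_mul_of_nonneg_left mN1 hM'.le
  have mN2' := mul_le_mul_of_nonneg_left mN2 hM'.le
  have eD : K * (M : ℝ) ^ 2 * (c.Clo ^ 2 * (((M : ℝ) - 1) / M)) =
      M * (K * (((M : ℝ) - 1) * c.Clo ^ 2)) := by field_simp
  refine sinr_mem_Icc c hK hM hClo hChi hc.sigma_pos (norm_nonneg _) (by positivity)
    (by positivity) ?_ ?_ ?_ ?_ ?_ ?_
  · linarith [dS'.1]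
  · linarith [dS'.2]
  · rw [mul_sub, eD]; linarith [dD'.1]
  · rw [mul_add]; linarith [dD'.2]
  · rw [mul_sub]; linarith [dN'.1]
  · rw [mul_add]; linarith [dN'.2]

end RelayNetwork

open RelayNetwork

theorem theorem2
    {Ω : Type*} [MeasurableSpace Ω] (μ : Measure Ω) [IsProbabilityMeasure μ]
    (c : RelayNetwork.Constants)
    (hElo : 0 < c.Elo) (hPlo : 0 < c.Plo) (hPrel : 0 < c.Prel) (hsigma : 0 < c.sigma)
    (K M : ℕ) (hK : 2 ≤ K) (hM : 2 ≤ M)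
    (E : Fin K → Fin M → ℝ) (hE : ∀ k m, c.Elo ≤ E k m ∧ E k m ≤ c.Ehi)
    (P : Fin M → Fin K → ℝ) (hP : ∀ m k, c.Plo ≤ P m k ∧ P m k ≤ c.Phi)
    (h : Fin K → Fin M → Ω → ℂ) (f : Fin M → Fin K → Ω → ℂ)
    (hlaw : ∀ k m, HasLaw (h k m) (RelayNetwork.circGaussian 1) μ)
    (flaw : ∀ m k, HasLaw (f m k) (RelayNetwork.circGaussian 1) μ)
    (hindep : iIndepFun
      (Sum.elim (fun p : Fin K × Fin M => h p.1 p.2) (fun p : Fin M × Fin K => f p.1 p.2)) μ)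
    (x : ℝ) (hx : 1 ≤ x) (m : Fin M) :
    μ.real {ω | RelayNetwork.sinrP2 c E P (fun k m' => h k m' ω) (fun m' k => f m' k ω) m ∉
        Set.Icc (RelayNetwork.LP2 c K M x) (RelayNetwork.UP2 c K M x)} ≤
      814 * (K : ℝ) ^ 2 * (M : ℝ) ^ 3 *
        Real.exp (-(RelayNetwork.DeltaP2 c * x ^ (2 / 9 : ℝ))) := by
  have hK2 : (2 : ℝ) ≤ K := by exact_mod_cast hK
  have hM2 : (2 : ℝ) ≤ M := by exact_mod_cast hM
  set τ := DeltaP2 c * x ^ (2 / 9 : ℝ) with hτdef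
  have hKM4 : (4 : ℝ) ≤ K * M := by nlinarith
  have hKM : (K : ℝ) * M ≤ (K : ℝ) ^ 2 * (M : ℝ) ^ 3 := by
    calc (K : ℝ) * M ≤ (K * M) * (K * (M : ℝ) ^ 2) :=
          le_mul_of_one_le_right (by positivity) (by nlinarith)
      _ = _ := by ring
  have hcount : (22 + 6 * K + 4 * K * M : ℝ) ≤ 814 * (K : ℝ) ^ 2 * (M : ℝ) ^ 3 := by
    have h1 : (K : ℝ) * 2 ≤ K * M := by gcongr
    linarith
  rcases le_or_gt τ 1 with hτ | hτ
  · -- For `τ ≤ 1` the right-hand side exceeds `1`.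
    refine measureReal_le_one.trans ?_
    have h1 : Real.exp (-1) ≤ Real.exp (-τ) := Real.exp_le_exp.2 (by linarith)
    have h2 : (1 / 3 : ℝ) ≤ Real.exp (-1) := by
      rw [Real.exp_neg, ← one_div]
      exact one_div_le_one_div_of_le (Real.exp_pos _) (by linarith [Real.exp_one_lt_d9])
    have h3 : (3 : ℝ) ≤ 814 * (K : ℝ) ^ 2 * (M : ℝ) ^ 3 := by linarith
    calc (1 : ℝ) = 3 * (1 / 3) := by norm_num
      _ ≤ _ := mul_le_mul h3 (h2.trans h1) (by norm_num) (by linarith)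
  have hc : c.Bounds E P := ⟨hElo, hPlo, hPrel, hsigma, hE, hP⟩
  have k₀ : Fin K := ⟨0, by omega⟩
  have hClo : 0 < c.Clo := by
    have h1 : 0 < c.Ehi := hElo.trans_le ((hE k₀ m).1.trans (hE k₀ m).2)
    exact Real.sqrt_pos.2 (by positivity)
  have hChi : 0 < c.Chi :=
    hClo.trans_le ((coeffBig_mem hc (by omega) m m k₀).1.trans (coeffBig_mem hc (by omega) m m k₀).2)
  have hchi : 0 < c.chi := by
    have h1 : 0 < c.Phi := hPlo.trans_le ((hP m k₀).1.trans (hP m k₀).2)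
    exact Real.sqrt_pos.2 (by positivity)
  obtain ⟨hx0, hx1, hx2⟩ := x_lower_bounds c hChi hchi hx hτ.le
  set Z : Ω → Chan K M → ℂ := fun ω i => Sum.elim (fun p : Fin K × Fin M => h p.1 p.2)
    (fun p : Fin M × Fin K => f p.1 p.2) i ω with hZ
  have hZlaw : HasLaw Z (gaussFamily (Chan K M)) μ :=
    hindep.hasLaw_pi (μ := fun _ => circGaussian 1) (by
      rintro (⟨k, n⟩ | ⟨n, k⟩)
      · exact hlaw k n
      · exact flaw n k)
  have hbad := measureReal_not_typical_le (fun k => coeffBig c E P m m k)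
    (interferenceGain c E P m) (fun k => coeffSmall c E P m k) m
    (fun k => by simp [interferenceGain]) hτ.le
  set B := {z : Chan K M → ℂ | ¬Typical (fun k => coeffBig c E P m m k)
    (interferenceGain c E P m) (fun k => coeffSmall c E P m k) m τ z} with hB
  calc μ.real _ ≤ μ.real (Z ⁻¹' B) := by
        refine measureReal_mono (fun ω hω => ?_) (measure_ne_top _ _)
        simp only [Set.mem_preimage, hB, Set.mem_ofPred_eq] at hω ⊢
        intro hcon
        have hmem := hcon.sinrP2_mem hc (by omega) hτ.le hx0 hx1 hx2 hClo hChi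
        simp only [hZ, Sum.elim_inl, Sum.elim_inr] at hmem
        exact hω hmem
    _ ≤ (gaussFamily (Chan K M)).real B := by
        rw [← hZlaw.map_eq]
        have : IsProbabilityMeasure (μ.map Z) := by rw [hZlaw.map_eq]; infer_instance
        exact ENNReal.toReal_mono (measure_ne_top _ _) (Measure.le_map_apply hZlaw.aemeasurable B)
    _ ≤ (22 + 6 * K + 4 * K * M) * Real.exp (-τ) := hbad
    _ ≤ _ := mul_le_mul_of_nonneg_right hcount (Real.exp_nonneg _)

end
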